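/- **Theorem (exponential growth).** Let $G$ be a non-elementary group (no finite-index subgroup of $G$ is isomorphic to $\mathbb Z$ or trivial), acting properly and by isometries on a proper geodesic metric space $(Y,d)$. A subset $X\subset Y$ is *contracting* if for some $C\ge 1$ every geodesic segment $\gamma$ with $d(\gamma,X)\ge C$ has nearest-point projection to $X$ of diameter at most $C$. An element $h\in G$ is *contracting* if, for some $p\in Y$, the set $\{h^np:n\in\mathbb Z\}$ is contracting and $n\mapsto h^np$ is a quasi-isometric embedding $\mathbb Z\to Y$. Assume that $G$ has a contracting element. Fix $o\in Y$. For $\Gamma\subset G$ put $$N(o,n)=\{g\in G: d(o,go)\le n\},\quad A(o,n,\Delta)=\{g\in G: |d(o,go)-n|\le\Delta\},\quad \omega(\Gamma)=\limsup_{n\to\infty}\frac{\log\sharp(N(o,n)\cap\Gamma)}{n}\in[-\infty,\infty],$$ with $\log 0=-\infty$ and $\exp(\infty)=\infty$. Write $f\prec g$ if there is a constant $K\in(0,\infty)$ with $f(n)<K g(n)$ for all integers $n\ge1$, and $f\asymp g$ if $f\prec g$ and $g\prec f$. Then: 1. the critical exponent of $G$ is a true limit: $\displaystyle \omega(G)=\lim_{n\to\infty}\frac{\log\sharp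 N(o,n)}{n}$ (in $[-\infty,\infty]$); 2. for every $\Delta>0$, $\ \sharp A(o,n,\Delta)\prec\exp(\omega(G)\,n)$, where the constant may depend on $\Delta$; 3. if the action is statistically convex-cocompact, then $G$ has purely exponential growth: there is $\Delta>0$ with $\sharp A(o,n,\Delta)\asymp\exp(\omega(G)\,n)$. Here the action is *statistically convex-cocompact (SCC)* if for some basepoint $p\in Y$ there are constants $0<M_1\le M_2$ with $\omega(\mathcal O_{M_1,M_2})<\omega(G)$ (exponents computed at $p$), where $\mathcal O_{M_1,M_2}$ is the set of $g\in G$ such that some geodesic from the closed ball $B(p,M_2)$ to the closed ball $B(gp,M_2)$ has its interior outside the closed $M_1$-neighbourhood of the orbit $Gp$. -/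

import Mathlib

open Filter Topology
open scoped ENNReal NNReal

/-- `γ`, restricted to `[0, L]`, is a geodesic segment of length `L` parametrized by arc length. -/
def IsGeodesicSegment {Y : Type*} [MetricSpace Y] (γ : ℝ → Y) (L : ℝ) : Prop :=
  0 ≤ L ∧ ∀ s ∈ Set.Icc 0 L, ∀ t ∈ Set.Icc 0 L, dist (γ s) (γ t) = |s - t|

/-- Any two points are joined by a geodesic segment. -/
def IsGeodesicSpace (Y : Type*) [MetricSpace Y] : Prop :=
  ∀ x y : Y, ∃ γ : ℝ → Y, ∃ L : ℝ, IsGeodesicSegment γ L ∧ γ 0 = x ∧ γ L = y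

/-- The set of nearest points in `X` to the point `y`. -/
def nearestPoints {Y : Type*} [MetricSpace Y] (X : Set Y) (y : Y) : Set Y :=
  {x | x ∈ X ∧ ∀ z ∈ X, dist y x ≤ dist y z}

/-- The nearest point projection of the set `A` to `X`. -/
def nearestProj {Y : Type*} [MetricSpace Y] (X A : Set Y) : Set Y :=
  ⋃ a ∈ A, nearestPoints X a

/-- `X` is `C`-contracting (with respect to all geodesics): every geodesic segment at distance at
least `C` from `X` has projection to `X` of diameter at most `C`. -/
def IsContractingWith {Y : Type*} [MetricSpace Y] (C : ℝ) (X : Set Y) : Prop :=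
  ∀ (γ : ℝ → Y) (L : ℝ), IsGeodesicSegment γ L →
    (∀ t ∈ Set.Icc 0 L, ∀ x ∈ X, C ≤ dist (γ t) x) →
    ∀ p ∈ nearestProj X (γ '' Set.Icc 0 L), ∀ q ∈ nearestProj X (γ '' Set.Icc 0 L), dist p q ≤ C

/-- `X` is contracting: it is `C`-contracting for some `C ≥ 1`. -/
def IsContractingSet {Y : Type*} [MetricSpace Y] (X : Set Y) : Prop :=
  ∃ C : ℝ, 1 ≤ C ∧ IsContractingWith C X

/-- A map `ℤ → Y` that is a quasi-isometric embedding. -/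
def IsQuasiIsometricEmbeddingInt {Y : Type*} [MetricSpace Y] (f : ℤ → Y) : Prop :=
  ∃ l c : ℝ, 1 ≤ l ∧ 0 ≤ c ∧ ∀ m n : ℤ,
    l⁻¹ * |(m : ℝ) - n| - c ≤ dist (f m) (f n) ∧ dist (f m) (f n) ≤ l * |(m : ℝ) - n| + c

/-- The element `h` is contracting: for some point `p`, the orbit of `p` under the subgroup
generated by `h` is a contracting subset and `n ↦ hⁿ p` is a quasi-isometric embedding.
(In particular `h` has infinite order.) -/
def IsContractingElement {G Y : Type*} [Group G] [MetricSpace Y] [MulAction G Y] (h : G) : Prop :=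
  ∃ p : Y, IsContractingSet (Set.range fun n : ℤ => h ^ n • p) ∧
    IsQuasiIsometricEmbeddingInt fun n : ℤ => h ^ n • p

/-- No finite-index subgroup is isomorphic to `ℤ` or to the trivial group. -/
def IsNonElementary (G : Type*) [Group G] : Prop :=
  ¬ ∃ H : Subgroup G, H.FiniteIndex ∧ (Nonempty (H ≃* Multiplicative ℤ) ∨ H = ⊥)

/-- The orbit ball `N(o, n) = {g | d(o, g o) ≤ n}`. -/
def orbitBall (G : Type*) {Y : Type*} [Group G] [MetricSpace Y] [MulAction G Y] (o : Y) (n : ℝ) :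
    Set G :=
  {g | dist o (g • o) ≤ n}

/-- The annulus `A(o, n, Δ) = {g | |d(o, g o) - n| ≤ Δ}`. -/
def orbitAnnulus (G : Type*) {Y : Type*} [Group G] [MetricSpace Y] [MulAction G Y] (o : Y)
    (n Δ : ℝ) : Set G :=
  {g | |dist o (g • o) - n| ≤ Δ}

/-- `log ♯(N(o, n) ∩ Γ) / n`, an extended real (`log 0 = -∞`, `log ∞ = ∞`). -/
noncomputable def growthQuotient {G Y : Type*} [Group G] [MetricSpace Y] [MulAction G Y] (o : Y)
    (Γ : Set G) (n : ℕ) : EReal :=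
  ENNReal.log (((orbitBall G o n ∩ Γ).encard : ℕ∞) : ℝ≥0∞) / (n : EReal)

/-- The critical exponent `ω(Γ) = limsup log ♯(N(o, n) ∩ Γ) / n` of a subset `Γ` of `G`. -/
noncomputable def criticalExponent {G Y : Type*} [Group G] [MetricSpace Y] [MulAction G Y] (o : Y)
    (Γ : Set G) : EReal :=
  limsup (growthQuotient o Γ) atTop

/-- The concave region `𝒪_{M₁, M₂}`: elements `g` for which some geodesic from the closed ball
`B(o, M₂)` to the closed ball `B(g o, M₂)` has its interior outside the closed
`M₁`-neighbourhood of the orbit `G o`. -/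
def concaveRegion (G : Type*) {Y : Type*} [Group G] [MetricSpace Y] [MulAction G Y] (o : Y)
    (M₁ M₂ : ℝ) : Set G :=
  {g | ∃ (γ : ℝ → Y) (L : ℝ), IsGeodesicSegment γ L ∧
    γ 0 ∈ Metric.closedBall o M₂ ∧ γ L ∈ Metric.closedBall (g • o) M₂ ∧
    ∀ t ∈ Set.Ioo 0 L, γ t ∉ Metric.cthickening M₁ (MulAction.orbit G o)}

/-- The action of `G` is statistically convex-cocompact, as seen from the basepoint `o`. -/
def IsStatConvexCocompact (G : Type*) {Y : Type*} [Group G] [MetricSpace Y] [MulAction G Y]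
    (o : Y) : Prop :=
  ∃ M₁ M₂ : ℝ, 0 < M₁ ∧ M₁ ≤ M₂ ∧
    criticalExponent o (concaveRegion G o M₁ M₂) < criticalExponent o (Set.univ : Set G)

/-- `f ≺ g` on positive integers: `f n < C g n` for some constant `C > 0` and all `n ≥ 1`. -/
def CoarselyLE (f g : ℕ → ℝ≥0∞) : Prop :=
  ∃ C : ℝ≥0, 0 < C ∧ ∀ n : ℕ, 1 ≤ n → f n < C * g n

/-- `f ≍ g` on positive integers. -/
def CoarselyEq (f g : ℕ → ℝ≥0∞) : Prop :=
  CoarselyLE f g ∧ CoarselyLE g f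

/-- The function `n ↦ ♯A(o, n, Δ)`. -/
noncomputable def annulusCount (G : Type*) {Y : Type*} [Group G] [MetricSpace Y] [MulAction G Y]
    (o : Y) (Δ : ℝ) (n : ℕ) : ℝ≥0∞ :=
  (((orbitAnnulus G o n Δ).encard : ℕ∞) : ℝ≥0∞)

/-- The function `n ↦ exp(ω(G) n)`. -/
noncomputable def expGrowth (G : Type*) {Y : Type*} [Group G] [MetricSpace Y] [MulAction G Y]
    (o : Y) (n : ℕ) : ℝ≥0∞ :=
  EReal.exp (criticalExponent o (Set.univ : Set G) * (n : EReal))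

open scoped Pointwise

/-! ### Continuous functions on intervals -/

/-! The engine for the first two claims is the extension lemma `exists_finite_extension`: for
suitable `f` in a fixed finite set, every geodesic from `o` to `g f k o` passes near `g o`. Hence
`d(o, g f k o)` is `d(o, g o) + d(o, k o)` up to a bounded error, and for `g` in a fixed annulus the
product determines `(g, k)` up to boundedly many choices. This gives `♯A(o, n, Δ) · ♯N(o, m) ≤ A
♯N(o, m + n + K)`. Iterating in `m` with a single `n` shows that one annulus of size `A exp(w (n +
A))` already forces the liminf of the growth quotients to be at least `w`
(`exists_le_liminf_of_annulus_large`). So no annulus can exceed a multiple of `exp(ω n)`; and if the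
liminf were below some `w < ω`, all annuli would be so small that summing them would give `ω ≤ w`.

For the lower bound, fix `σ` strictly between the exponents of the concave region and of `G`, and
let `P(r)` be the Poincaré series at `σ` truncated at radius `r`. Cutting a geodesic from `o` to `g
o`, and removing the excursion from the orbit around the cut point, writes `g = u k w` with `k`
concave. The series over concave elements converges at `σ`, so `P(r + q) ≤ K P(r) P(q)`, whence
`P(n) ≥ exp((ω - σ) n) / K`. The annulus upper bound gives `P(n) ≤ D exp((ω - σ) n)`. Thus `P(n + J)
- P(n)` is of order `exp((ω - σ) n)` for a large fixed `J`, and this difference is a sum over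
elements of one annulus. -/

/-- The endpoints are the last time up to `t` and the first time from `t` on with `f ≤ c`. If `f t ≤
c`, both are `t` and the open interval is empty. -/
theorem exists_excursion {f : ℝ → ℝ} {a b c t : ℝ} (hf : ContinuousOn f (Set.Icc a b))
    (ha : f a ≤ c) (hb : f b ≤ c) (ht : t ∈ Set.Icc a b) :
    ∃ s ∈ Set.Icc a t, ∃ s' ∈ Set.Icc t b, f s ≤ c ∧ f s' ≤ c ∧ ∀ u ∈ Set.Ioo s s', c < f u := by
  have hK : IsCompact (Set.Icc a t ∩ f ⁻¹' Set.Iic c) :=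
    isCompact_Icc.of_isClosed_subset
      ((hf.mono (Set.Icc_subset_Icc_right ht.2)).preimage_isClosed_of_isClosed isClosed_Icc
        isClosed_Iic) Set.inter_subset_left
  have hK' : IsCompact (Set.Icc t b ∩ f ⁻¹' Set.Iic c) :=
    isCompact_Icc.of_isClosed_subset
      ((hf.mono (Set.Icc_subset_Icc_left ht.1)).preimage_isClosed_of_isClosed isClosed_Icc
        isClosed_Iic) Set.inter_subset_left
  obtain ⟨s, hs, hs'⟩ := hK.exists_isGreatest ⟨a, ⟨le_rfl, ht.1⟩, ha⟩
  obtain ⟨r, hr, hr'⟩ := hK'.exists_isLeast ⟨b, ⟨ht.2, le_rfl⟩, hb⟩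
  refine ⟨s, hs.1, r, hr.1, hs.2, hr.2, fun u hu => ?_⟩
  by_contra! h
  rcases le_total u t with hut | hut
  · exact absurd (hs' ⟨⟨hs.1.1.trans hu.1.le, hut⟩, h⟩) (not_le.2 hu.1)
  · exact absurd (hr' ⟨⟨hut, hu.2.le.trans hr.1.2⟩, h⟩) (not_le.2 hu.2)

theorem le_on_Icc_of_le_on_Ioo {f : ℝ → ℝ} {a b c : ℝ} (hf : ContinuousOn f (Set.Icc a b))
    (hab : a < b) (h : ∀ u ∈ Set.Ioo a b, c ≤ f u) : ∀ u ∈ Set.Icc a b, c ≤ f u := by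
  intro u hu
  rw [← closure_Ioo hab.ne] at hu hf
  exact le_on_closure h continuousOn_const hf hu

/-! ### Geodesic segments -/

section Geodesic

variable {Y : Type*} [MetricSpace Y] {γ : ℝ → Y} {L : ℝ}

theorem IsGeodesicSegment.dist_eq (h : IsGeodesicSegment γ L) {s t : ℝ} (hs : 0 ≤ s) (hst : s ≤ t)
    (ht : t ≤ L) : dist (γ s) (γ t) = t - s := by
  rw [h.2 s ⟨hs, hst.trans ht⟩ t ⟨hs.trans hst, ht⟩, abs_sub_comm, abs_of_nonneg (by linarith)]

theorem IsGeodesicSegment.length_eq (h : IsGeodesicSegment γ L) : dist (γ 0) (γ L) = L := by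
  rw [h.dist_eq le_rfl h.1 le_rfl, sub_zero]

theorem IsGeodesicSegment.continuousOn (h : IsGeodesicSegment γ L) :
    ContinuousOn γ (Set.Icc 0 L) :=
  LipschitzOnWith.continuousOn (K := 1) <| LipschitzOnWith.of_dist_le_mul fun s hs t ht => by
    rw [h.2 s hs t ht, Real.dist_eq]; simp

theorem IsGeodesicSegment.infDist_continuousOn (h : IsGeodesicSegment γ L) (X : Set Y) :
    ContinuousOn (fun t => Metric.infDist (γ t) X) (Set.Icc 0 L) :=
  (Metric.continuous_infDist_pt X).comp_continuousOn h.continuousOn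

theorem IsGeodesicSegment.sub (h : IsGeodesicSegment γ L) {s t : ℝ} (hs : 0 ≤ s) (hst : s ≤ t)
    (ht : t ≤ L) : IsGeodesicSegment (fun u => γ (s + u)) (t - s) := by
  refine ⟨by linarith, fun u hu v hv => ?_⟩
  rw [h.2 _ ⟨by linarith [hu.1], by linarith [hu.2]⟩ _ ⟨by linarith [hv.1], by linarith [hv.2]⟩]
  congr 1; ring

theorem IsGeodesicSegment.reverse (h : IsGeodesicSegment γ L) :
    IsGeodesicSegment (fun u => γ (L - u)) L := by
  refine ⟨h.1, fun u hu v hv => ?_⟩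
  rw [h.2 _ ⟨by linarith [hu.2], by linarith [hu.1]⟩ _ ⟨by linarith [hv.2], by linarith [hv.1]⟩,
    abs_sub_comm]
  congr 1; ring

theorem IsGeodesicSegment.smul {G : Type*} [Group G] [MulAction G Y] [IsIsometricSMul G Y]
    (h : IsGeodesicSegment γ L) (g : G) : IsGeodesicSegment (fun u => g • γ u) L :=
  ⟨h.1, fun u hu v hv => by rw [dist_smul, h.2 u hu v hv]⟩

end Geodesic

/-! ### Contracting sets -/

section Contracting

variable {Y : Type*} [MetricSpace Y] {X : Set Y} {C : ℝ} {γ : ℝ → Y} {L : ℝ}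

/-- Every point has a nearest point in `X`. -/
def IsProximinal (X : Set Y) : Prop := ∀ y, (nearestPoints X y).Nonempty

theorem infDist_eq_of_mem_nearestPoints {y x : Y} (h : x ∈ nearestPoints X y) :
    Metric.infDist y X = dist y x :=
  le_antisymm (Metric.infDist_le_dist_of_mem h.1) <|
    (Metric.le_infDist ⟨x, h.1⟩).2 fun _ hz => h.2 _ hz

theorem mem_nearestPoints_self {x : Y} (h : x ∈ X) : x ∈ nearestPoints X x :=
  ⟨h, fun z _ => by rw [dist_self]; exact dist_nonneg⟩

/-- A nearest point stays nearest for the points of a geodesic towards it. -/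
theorem IsGeodesicSegment.mem_nearestPoints (h : IsGeodesicSegment γ L)
    (hX : γ L ∈ nearestPoints X (γ 0)) {t : ℝ} (ht : t ∈ Set.Icc 0 L) :
    γ L ∈ nearestPoints X (γ t) := by
  refine ⟨hX.1, fun z hz => ?_⟩
  have h1 := hX.2 z hz
  have h2 := dist_triangle (γ 0) (γ t) z
  rw [h.length_eq] at h1
  rw [h.dist_eq le_rfl ht.1 ht.2] at h2
  rw [h.dist_eq ht.1 ht.2 le_rfl]
  linarith

theorem IsContractingWith.dist_le (hC : IsContractingWith C X) (h : IsGeodesicSegment γ L)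
    {s t : ℝ} (hs : 0 ≤ s) (hst : s ≤ t) (ht : t ≤ L)
    (hfar : ∀ u ∈ Set.Icc s t, C ≤ Metric.infDist (γ u) X)
    {p q : Y} (hp : p ∈ nearestPoints X (γ s)) (hq : q ∈ nearestPoints X (γ t)) :
    dist p q ≤ C := by
  refine hC _ _ (h.sub hs hst ht) (fun u hu x hx => ?_) p ?_ q ?_
  · exact (hfar _ ⟨by linarith [hu.1], by linarith [hu.2]⟩).trans
      (Metric.infDist_le_dist_of_mem hx)
  · exact Set.mem_biUnion ⟨0, ⟨le_rfl, by linarith⟩, by simp⟩ hp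
  · exact Set.mem_biUnion ⟨t - s, ⟨by linarith, le_rfl⟩, by simp⟩ hq

/-- Since the endpoints project more than `C` apart, the geodesic must come within `C` of `X`. Up to
the first such time it is far from `X`, so its projection has moved by at most `C` from `p`; the
remaining `C` is the distance to `X`. -/
theorem IsContractingWith.exists_dist_le_left (hC : IsContractingWith C X) (hC0 : 0 ≤ C)
    (hX : IsProximinal X) (h : IsGeodesicSegment γ L)
    {p q : Y} (hp : p ∈ nearestPoints X (γ 0)) (hq : q ∈ nearestPoints X (γ L))
    (hpq : C < dist p q) : ∃ t ∈ Set.Icc 0 L, dist (γ t) p ≤ 2 * C := by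
  have hf := h.infDist_continuousOn X
  have hK : IsCompact (Set.Icc 0 L ∩ (fun t => Metric.infDist (γ t) X) ⁻¹' Set.Iic C) :=
    isCompact_Icc.of_isClosed_subset
      (hf.preimage_isClosed_of_isClosed isClosed_Icc isClosed_Iic) Set.inter_subset_left
  have hne : (Set.Icc 0 L ∩ (fun t => Metric.infDist (γ t) X) ⁻¹' Set.Iic C).Nonempty := by
    by_contra! hempty
    refine hpq.not_ge (hC.dist_le h le_rfl h.1 le_rfl (fun u hu => ?_) hp hq)
    by_contra! hlt
    exact (hempty.subset ⟨hu, hlt.le⟩ : u ∈ (∅ : Set ℝ))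
  obtain ⟨s, hs, hs'⟩ := hK.exists_isLeast hne
  refine ⟨s, hs.1, ?_⟩
  rcases hs.1.1.eq_or_lt with rfl | hpos
  · rw [← infDist_eq_of_mem_nearestPoints hp]
    exact le_trans hs.2 (by linarith)
  · obtain ⟨r, hr⟩ := hX (γ s)
    have h1 : dist p r ≤ C := by
      refine hC.dist_le h le_rfl hpos.le hs.1.2 ?_ hp hr
      refine le_on_Icc_of_le_on_Ioo (hf.mono (Set.Icc_subset_Icc_right hs.1.2)) hpos fun u hu => ?_
      by_contra! hlt
      exact absurd (hs' ⟨⟨hu.1.le, hu.2.le.trans hs.1.2⟩, hlt.le⟩) (not_le.2 hu.2)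
    have h2 : dist (γ s) r ≤ C := by
      rw [← infDist_eq_of_mem_nearestPoints hr]; exact hs.2
    have := dist_triangle_right (γ s) p r
    linarith

theorem IsContractingWith.exists_dist_le_right (hC : IsContractingWith C X) (hC0 : 0 ≤ C)
    (hX : IsProximinal X) (h : IsGeodesicSegment γ L)
    {p q : Y} (hp : p ∈ nearestPoints X (γ 0)) (hq : q ∈ nearestPoints X (γ L))
    (hpq : C < dist p q) : ∃ t ∈ Set.Icc 0 L, dist (γ t) q ≤ 2 * C := by
  obtain ⟨t, ht, h'⟩ := hC.exists_dist_le_left hC0 hX h.reverse (p := q) (q := p)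
    (by simpa using hq) (by simpa using hp) (by rwa [dist_comm])
  exact ⟨L - t, ⟨by linarith [ht.2], by linarith [ht.1]⟩, h'⟩

/-- Either the projections are `C`-close, or the geodesic passes within `2 * C` of both. -/
theorem IsContractingWith.dist_proj_le (hC : IsContractingWith C X) (hC0 : 0 ≤ C)
    (hX : IsProximinal X) (hY : IsGeodesicSpace Y) {x y p q : Y}
    (hp : p ∈ nearestPoints X x) (hq : q ∈ nearestPoints X y) :
    dist p q ≤ dist x y + 4 * C := by
  by_cases hpq : dist p q ≤ C
  · linarith [dist_nonneg (x := x) (y := y)]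
  obtain ⟨γ, L, h, rfl, rfl⟩ := hY x y
  obtain ⟨s, hs, h1⟩ := hC.exists_dist_le_left hC0 hX h hp hq (not_le.1 hpq)
  obtain ⟨t, ht, h2⟩ := hC.exists_dist_le_right hC0 hX h hp hq (not_le.1 hpq)
  have h3 : dist (γ s) (γ t) ≤ L := by
    rw [h.2 s hs t ht, abs_le]; constructor <;> linarith [hs.1, hs.2, ht.1, ht.2]
  have h4 := dist_triangle4 p (γ s) (γ t) q
  rw [dist_comm p (γ s)] at h4
  rw [h.length_eq]
  linarith

/-- Contracting sets are quasiconvex. -/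
theorem IsContractingWith.infDist_le (hC : IsContractingWith C X)
    (hX : IsProximinal X) (h : IsGeodesicSegment γ L) {c : ℝ} (hc : C ≤ c) {s t u : ℝ}
    (hs : 0 ≤ s) (ht : t ≤ L)
    (hsc : Metric.infDist (γ s) X ≤ c) (htc : Metric.infDist (γ t) X ≤ c)
    (hu : u ∈ Set.Icc s t) : Metric.infDist (γ u) X ≤ 3 * c + C := by
  have hf := (h.infDist_continuousOn X).mono (Set.Icc_subset_Icc hs ht)
  obtain ⟨a, ha, b, hb, hac, hbc, hab⟩ := exists_excursion hf hsc htc hu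
  have hc0 : 0 ≤ c := Metric.infDist_nonneg.trans hsc
  obtain ⟨p, hp⟩ := hX (γ a)
  obtain ⟨q, hq⟩ := hX (γ b)
  have hC0 : 0 ≤ C := by
    by_contra! hneg
    have := hC.dist_le h (hs.trans ha.1) le_rfl (by linarith [ha.2, hb.1, hb.2])
      (fun u _ => hneg.le.trans Metric.infDist_nonneg) hp hp
    rw [dist_self] at this
    linarith
  rcases (ha.2.trans hb.1).eq_or_lt with heq | hlt
  · have : u = a := le_antisymm (heq ▸ hb.1) ha.2
    subst this; linarith
  -- The excursion above level `c` has projection of diameter at most `C` and ends within `c` of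
  -- `X`, so its length is at most `2 * c + C`.
  have h1 : dist p q ≤ C := hC.dist_le h (hs.trans ha.1) hlt.le (hb.2.trans ht)
    (fun v hv => hc.trans (le_on_Icc_of_le_on_Ioo (hf.mono (Set.Icc_subset_Icc ha.1 hb.2)) hlt
      (fun v hv => (hab v hv).le) v hv)) hp hq
  rw [infDist_eq_of_mem_nearestPoints hp] at hac
  rw [infDist_eq_of_mem_nearestPoints hq] at hbc
  have h2 := dist_triangle4 (γ a) p q (γ b)
  rw [h.dist_eq (hs.trans ha.1) hlt.le (hb.2.trans ht), dist_comm q] at h2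
  have h3 := dist_triangle (γ u) (γ a) p
  rw [dist_comm (γ u) (γ a), h.dist_eq (hs.trans ha.1) ha.2 (hu.2.trans ht)] at h3
  linarith [Metric.infDist_le_dist_of_mem (x := γ u) hp.1, hb.1]

/-- Behrstock's inequality: if the projection of `X₁` to `X₂` is near `p₂`, then a point which
projects far away from `p₂` in `X₂` projects near `p₁` in `X₁`. -/
theorem IsContractingWith.behrstock {X₁ X₂ : Set Y} (hC₁ : IsContractingWith C X₁)
    (hC₂ : IsContractingWith C X₂) (hC0 : 0 ≤ C) (hX₁ : IsProximinal X₁) (hX₂ : IsProximinal X₂)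
    (hY : IsGeodesicSpace Y) {p₁ p₂ : Y} (hp₁ : p₁ ∈ X₁) {B : ℝ}
    (hB : ∀ x ∈ X₁, ∀ r ∈ nearestPoints X₂ x, dist r p₂ ≤ B) {y q₁ q₂ : Y}
    (hq₁ : q₁ ∈ nearestPoints X₁ y) (hq₂ : q₂ ∈ nearestPoints X₂ y) (hfar : B + C < dist q₂ p₂) :
    dist q₁ p₁ ≤ B + 6 * C + 2 * dist p₁ p₂ := by
  obtain ⟨γ, L, h, rfl, rfl⟩ := hY y q₁
  obtain ⟨r, hr⟩ := hX₂ (γ L)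
  have h1 := hB _ hq₁.1 r hr
  -- The geodesic from `y` to its projection `q₁` passes close to `r`, hence close to `p₂`. The
  -- point of passage still projects to `q₁`, so the Lipschitz bound for projections to `X₁`
  -- compares `q₁` with `p₁`.
  obtain ⟨t, ht, h2⟩ := hC₂.exists_dist_le_right hC0 hX₂ h hq₂ hr (by
    linarith [dist_triangle q₂ r p₂])
  have h3 := h.mem_nearestPoints hq₁ ht
  have h5 := hC₁.dist_proj_le hC0 hX₁ hY h3 (mem_nearestPoints_self hp₁)
  have h6 := dist_triangle4 (γ t) r p₂ p₁
  rw [dist_comm p₂] at h6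
  linarith [dist_nonneg (x := p₁) (y := p₂)]

section Smul

variable {G : Type*} [Group G] [MulAction G Y] [IsIsometricSMul G Y]

theorem smul_mem_nearestPoints_smul {x y : Y} (g : G) (h : x ∈ nearestPoints X y) :
    g • x ∈ nearestPoints (g • X) (g • y) := by
  refine ⟨Set.smul_mem_smul_set h.1, ?_⟩
  rintro _ ⟨z, hz, rfl⟩
  simpa only [dist_smul] using h.2 z hz

theorem inv_smul_mem_nearestPoints {x y : Y} {g : G} (h : x ∈ nearestPoints (g • X) y) :
    g⁻¹ • x ∈ nearestPoints X (g⁻¹ • y) := by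
  simpa using smul_mem_nearestPoints_smul g⁻¹ h

theorem IsProximinal.smul (h : IsProximinal X) (g : G) : IsProximinal (g • X) := fun y => by
  obtain ⟨x, hx⟩ := h (g⁻¹ • y)
  exact ⟨g • x, by simpa using smul_mem_nearestPoints_smul g hx⟩

theorem IsContractingWith.smul (h : IsContractingWith C X) (g : G) :
    IsContractingWith C (g • X) := by
  intro γ L hγ hfar p hp q hq
  have key : ∀ p ∈ nearestProj (g • X) (γ '' Set.Icc 0 L),
      g⁻¹ • p ∈ nearestProj X ((fun t => g⁻¹ • γ t) '' Set.Icc 0 L) := by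
    intro p hp
    simp only [nearestProj, Set.mem_iUnion] at hp
    obtain ⟨_, ⟨t, ht, rfl⟩, hp⟩ := hp
    exact Set.mem_biUnion ⟨t, ht, rfl⟩ (inv_smul_mem_nearestPoints hp)
  rw [← dist_smul g⁻¹]
  refine h _ L (hγ.smul g⁻¹) (fun t ht x hx => ?_) _ (key p hp) _ (key q hq)
  rw [← dist_smul g, smul_inv_smul]
  exact hfar t ht _ (Set.smul_mem_smul_set hx)

end Smul

end Contracting

/-! ### Proper actions -/

section Proper

variable {G Y : Type*} [Group G] [MetricSpace Y] [ProperSpace Y] [MulAction G Y]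
  [ProperlyDiscontinuousSMul G Y]

theorem finite_setOf_dist_smul_le (x y : Y) (r : ℝ) : {g : G | dist x (g • y) ≤ r}.Finite := by
  refine (ProperlyDiscontinuousSMul.finite_disjoint_inter_image (Γ := G)
    (isCompact_singleton (x := y)) (isCompact_closedBall x r)).subset fun g hg => ?_
  exact ⟨g • y, ⟨y, rfl, rfl⟩, by rw [Metric.mem_closedBall, dist_comm]; exact hg⟩

theorem exists_forall_dist_smul_le (S : Set G) (hS : S.Nonempty) (x y : Y) :
    ∃ g ∈ S, ∀ k ∈ S, dist x (g • y) ≤ dist x (k • y) := by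
  obtain ⟨g₀, hg₀⟩ := hS
  have hfin : (S ∩ {g : G | dist x (g • y) ≤ dist x (g₀ • y)}).Finite :=
    (finite_setOf_dist_smul_le x y _).subset Set.inter_subset_right
  obtain ⟨g, hg, hmin⟩ := Set.exists_min_image _ (fun g : G => dist x (g • y)) hfin
    ⟨g₀, hg₀, le_refl (dist x (g₀ • y))⟩
  refine ⟨g, hg.1, fun k hk => ?_⟩
  by_cases h : dist x (k • y) ≤ dist x (g₀ • y)
  · exact hmin k ⟨hk, h⟩
  · exact le_trans hg.2 (not_le.1 h).le

end Proper

/-! ### Axes -/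

section Axis

variable {G Y : Type*} [Group G] [MulAction G Y]

/-- The orbit of `p` under the powers of `h`. -/
def powerOrbit (h : G) (p : Y) : Set Y := Set.range fun n : ℤ => h ^ n • p

theorem zpow_smul_mem_powerOrbit (h : G) (p : Y) (n : ℤ) : h ^ n • p ∈ powerOrbit h p := ⟨n, rfl⟩

theorem mem_powerOrbit_self (h : G) (p : Y) : p ∈ powerOrbit h p := ⟨0, by simp⟩

theorem zpow_smul_powerOrbit (h : G) (p : Y) (n : ℤ) : h ^ n • powerOrbit h p = powerOrbit h p := by
  ext x
  constructor
  · rintro ⟨_, ⟨m, rfl⟩, rfl⟩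
    exact ⟨n + m, by simp [zpow_add, mul_smul]⟩
  · rintro ⟨m, rfl⟩
    exact ⟨h ^ (m - n) • p, ⟨_, rfl⟩, by simp [← mul_smul, ← zpow_add]⟩

variable [MetricSpace Y] [ProperSpace Y] [ProperlyDiscontinuousSMul G Y]
  {h : G} {p : Y} {C l c : ℝ}

theorem isProximinal_powerOrbit (h : G) (p : Y) : IsProximinal (powerOrbit h p) := fun y => by
  obtain ⟨_, ⟨n, rfl⟩, hn⟩ := exists_forall_dist_smul_le (Set.range fun n : ℤ => h ^ n)
    ⟨_, 0, rfl⟩ y p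
  refine ⟨h ^ n • p, ⟨n, rfl⟩, ?_⟩
  rintro _ ⟨m, rfl⟩
  exact hn _ ⟨m, rfl⟩

/-- A geodesic between `h ^ m • p` and `h ^ m' • p` with `m ≤ 0 ≤ m'` passes near `p`. -/
theorem exists_dist_le_of_zpow_endpoints (hC : 0 ≤ C)
    (hX : IsContractingWith C (powerOrbit h p)) (hl : 0 < l)
    (hq : ∀ m n : ℤ, l⁻¹ * |(m : ℝ) - n| - c ≤ dist (h ^ m • p) (h ^ n • p)) :
    ∃ R : ℝ, 0 ≤ R ∧ ∀ (γ : ℝ → Y) (L : ℝ), IsGeodesicSegment γ L → ∀ m m' : ℤ, m ≤ 0 → 0 ≤ m' →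
      γ 0 = h ^ m • p → γ L = h ^ m' • p → ∃ t ∈ Set.Icc 0 L, dist (γ t) p ≤ R := by
  have hP := isProximinal_powerOrbit h p
  -- Orbit points at distance less than `2 * (4 * C + 1)` have exponents differing by at most `N`.
  obtain ⟨N, hN⟩ := exists_nat_ge (l * (8 * C + 2 + c))
  have hfin : ((fun n : ℤ => dist (h ^ n • p) p) '' Set.Icc (-N : ℤ) N).Finite :=
    (Set.finite_Icc _ _).image _
  obtain ⟨R, hR⟩ := hfin.bddAbove
  refine ⟨4 * C + 1 + |R|, by positivity, fun γ L hγ m m' hm hm' h0 hL => ?_⟩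
  set P := (fun n : ℤ => h ^ n • p) '' Set.Ici 0
  set Q := (fun n : ℤ => h ^ n • p) '' Set.Iic 0
  have hQ : ∀ n : ℤ, n ≤ 0 → h ^ n • p ∈ Q := fun n hn => ⟨n, hn, rfl⟩
  have hP' : ∀ n : ℤ, 0 ≤ n → h ^ n • p ∈ P := fun n hn => ⟨n, hn, rfl⟩
  have hcl : ∀ X : Set Y,
      IsClosed (Set.Icc 0 L ∩ (fun t => Metric.infDist (γ t) X) ⁻¹' Set.Iic (4 * C)) := fun X =>
    (hγ.infDist_continuousOn X).preimage_isClosed_of_isClosed isClosed_Icc isClosed_Iic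
  have hself : ∀ n : ℤ, Metric.infDist (h ^ n • p) (powerOrbit h p) ≤ C := fun n => by
    rw [Metric.infDist_zero_of_mem (zpow_smul_mem_powerOrbit h p n)]; exact hC
  have hL0 := hγ.1
  -- By quasiconvexity the closed `4 * C`-neighbourhoods of the two half-orbits cover the segment.
  -- By connectedness some point is near both, say near exponents `i ≤ 0 ≤ k`; then `k - i ≤ N`
  -- keeps `k` in a finite range.
  obtain ⟨t, ht, htQ, htP⟩ := isPreconnected_closed_iff.1 (isPreconnected_Icc (a := (0 : ℝ)) (b := L))
    _ _ (hcl Q) (hcl P) (by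
      intro t ht
      have h1 := hX.infDist_le hP hγ le_rfl le_rfl le_rfl (by rw [h0]; exact hself m)
        (by rw [hL]; exact hself m') ht
      obtain ⟨_, ⟨n, rfl⟩, hn⟩ := hP (γ t)
      have hn' : h ^ n • p ∈ nearestPoints (powerOrbit h p) (γ t) := ⟨⟨n, rfl⟩, hn⟩
      rw [infDist_eq_of_mem_nearestPoints hn'] at h1
      rcases le_total n 0 with hn0 | hn0
      · refine Or.inl ⟨ht, ?_⟩
        have := Metric.infDist_le_dist_of_mem (x := γ t) (hQ n hn0)
        simp only [Set.mem_preimage, Set.mem_Iic]; linarith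
      · refine Or.inr ⟨ht, ?_⟩
        have := Metric.infDist_le_dist_of_mem (x := γ t) (hP' n hn0)
        simp only [Set.mem_preimage, Set.mem_Iic]; linarith)
    ⟨0, ⟨le_rfl, hL0⟩, ⟨le_rfl, hL0⟩, by
      simp only [Set.mem_preimage, Set.mem_Iic]
      rw [h0, Metric.infDist_zero_of_mem (hQ m hm)]; positivity⟩
    ⟨L, ⟨hL0, le_rfl⟩, ⟨hL0, le_rfl⟩, by
      simp only [Set.mem_preimage, Set.mem_Iic]
      rw [hL, Metric.infDist_zero_of_mem (hP' m' hm')]; positivity⟩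
  have htQ := htQ.2
  have htP := htP.2
  simp only [Set.mem_preimage, Set.mem_Iic] at htQ htP
  obtain ⟨_, ⟨i, hi, rfl⟩, hi'⟩ := (Metric.infDist_lt_iff ⟨_, hQ 0 le_rfl⟩).1
    (by linarith : Metric.infDist (γ t) Q < 4 * C + 1)
  obtain ⟨_, ⟨k, hk, rfl⟩, hk'⟩ := (Metric.infDist_lt_iff ⟨_, hP' 0 le_rfl⟩).1
    (by linarith : Metric.infDist (γ t) P < 4 * C + 1)
  simp only [Set.mem_Iic, Set.mem_Ici] at hi hk hi' hk'
  have h1 := dist_triangle_left (h ^ k • p) (h ^ i • p) (γ t)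
  have h2 := hq k i
  have h3 : |(k : ℝ) - i| ≤ N := by
    have : l⁻¹ * |(k : ℝ) - i| ≤ 8 * C + 2 + c := by linarith
    rw [inv_mul_le_iff₀ hl] at this
    linarith
  have h4 : k - i ≤ N := by
    have := (le_abs_self _).trans h3
    exact_mod_cast this
  have h5 : dist (h ^ k • p) p ≤ R := hR ⟨k, ⟨by omega, by omega⟩, rfl⟩
  refine ⟨t, ht, ?_⟩
  linarith [dist_triangle (γ t) (h ^ k • p) p, le_abs_self R]

variable [IsIsometricSMul G Y]

/-- If `g` does not commensurate `⟨h⟩`, then the projection of the `g`-translate of the axis of `h`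
to that axis is bounded. -/
theorem exists_bound_proj_translate (hY : IsGeodesicSpace Y) (hC : 0 ≤ C)
    (hX : IsContractingWith C (powerOrbit h p)) {g : G}
    (hg : ∀ a b : ℤ, g * h ^ a * g⁻¹ = h ^ b → a = 0) :
    ∃ B : ℝ, ∀ x ∈ g • powerOrbit h p, ∀ r ∈ nearestPoints (powerOrbit h p) x, dist r p ≤ B := by
  have hP := isProximinal_powerOrbit h p
  obtain ⟨r₀, hr₀⟩ := hP (g • p)
  -- A large projection makes a geodesic follow both axes for time `M * T`. Sampling it at `M + 1`
  -- times spaced by `T` gives elements `h ^ (-j) * g * h ^ i` moving `p` by less than `(4 * C + 1)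
  -- + (7 * C + 1)`, so two of them coincide. Then `g` conjugates `h ^ (i - i')` to a power of `h`,
  -- which forces `i = i'`; but two samples within `4 * C + 1` of one point are closer than `T`.
  have hfin := finite_setOf_dist_smul_le (G := G) p p (11 * C + 2)
  set M := hfin.toFinset.card with hM
  set T := 8 * C + 3 with hT
  refine ⟨dist r₀ p + (5 * C + M * T), fun x hx r hr => ?_⟩
  by_contra! hlt
  have hr₀r : 5 * C + M * T < dist r₀ r := by
    linarith [dist_triangle r r₀ p, dist_comm r r₀]
  have hMT : 0 ≤ M * T := by positivity
  obtain ⟨γ, L, hγ, h0, rfl⟩ := hY (g • p) x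
  rw [← h0] at hr₀
  obtain ⟨s, hs, hsr⟩ := hX.exists_dist_le_left hC hP hγ hr₀ hr (by linarith)
  obtain ⟨t, ht, htr⟩ := hX.exists_dist_le_right hC hP hγ hr₀ hr (by linarith)
  have hst : M * T ≤ |s - t| := by
    have := dist_triangle4 r₀ (γ s) (γ t) r
    rw [dist_comm r₀ (γ s), hγ.2 s hs t ht] at this
    linarith
  have near_s := (Metric.infDist_le_dist_of_mem (x := γ s) hr₀.1).trans hsr
  have near_t := (Metric.infDist_le_dist_of_mem (x := γ t) hr.1).trans htr
  obtain ⟨a, b, ha, hab, hb, hnear⟩ : ∃ a b : ℝ, 0 ≤ a ∧ M * T ≤ b - a ∧ b ≤ L ∧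
      ∀ u ∈ Set.Icc a b, Metric.infDist (γ u) (powerOrbit h p) ≤ 7 * C := by
    rcases le_total s t with h' | h'
    · refine ⟨s, t, hs.1, by rwa [abs_sub_comm, abs_of_nonneg (by linarith)] at hst, ht.2,
        fun u hu => ?_⟩
      have := hX.infDist_le hP hγ (c := 2 * C) (by linarith) hs.1 ht.2 near_s near_t hu
      linarith
    · refine ⟨t, s, ht.1, by rwa [abs_of_nonneg (by linarith)] at hst, hs.2, fun u hu => ?_⟩
      have := hX.infDist_le hP hγ (c := 2 * C) (by linarith) ht.1 hs.2 near_t near_s hu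
      linarith
  have hp := mem_powerOrbit_self h p
  have key : ∀ u ∈ Set.Icc a b, ∃ i j : ℤ, dist (γ u) (g • h ^ i • p) < 4 * C + 1 ∧
      dist (γ u) (h ^ j • p) < 7 * C + 1 := by
    intro u hu
    have h1 := (hX.smul g).infDist_le (hP.smul g) hγ (c := C) le_rfl le_rfl le_rfl
      (by rw [h0, Metric.infDist_zero_of_mem (Set.smul_mem_smul_set hp)]; exact hC)
      (by rw [Metric.infDist_zero_of_mem hx]; exact hC)
      (u := u) ⟨ha.trans hu.1, hu.2.trans hb⟩
    obtain ⟨_, ⟨_, ⟨i, rfl⟩, rfl⟩, hi⟩ := (Metric.infDist_lt_iff (r := 4 * C + 1)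
      ⟨_, Set.smul_mem_smul_set hp⟩).1 (by linarith : _ < 4 * C + 1)
    obtain ⟨_, ⟨j, rfl⟩, hj⟩ := (Metric.infDist_lt_iff ⟨_, hp⟩).1
      (by linarith [hnear u hu] : Metric.infDist (γ u) (powerOrbit h p) < 7 * C + 1)
    exact ⟨i, j, hi, hj⟩
  have hT0 : 0 < T := by positivity
  have htime : ∀ k : ℕ, k ≤ M → a + k * T ∈ Set.Icc a b := fun k hk => by
    have h1 : (k : ℝ) * T ≤ M * T := by gcongr
    have h2 : 0 ≤ (k : ℝ) * T := by positivity
    exact ⟨by linarith, by linarith⟩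
  choose! i j hi hj using key
  obtain ⟨k, hk, k', hk', hne, heq⟩ := Finset.exists_ne_map_eq_of_card_lt_of_maps_to
    (s := Finset.range (M + 1)) (t := hfin.toFinset)
    (f := fun k : ℕ => h ^ (-j (a + k * T)) * g * h ^ i (a + k * T)) (by simp [hM]) (by
      intro k hk
      have hk := htime k (by simpa [Nat.lt_succ_iff] using hk)
      have h1 := hi _ hk
      have h2 := hj _ hk
      simp only [Set.Finite.coe_toFinset, Set.mem_ofPred_eq]
      rw [← dist_smul (h ^ j (a + k * T))]
      simp only [mul_smul, zpow_neg, smul_inv_smul]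
      rw [dist_comm] at h2
      linarith [dist_triangle (h ^ j (a + k * T) • p) (γ (a + k * T)) (g • h ^ i (a + k * T) • p)])
  have hk := htime k (by simpa [Nat.lt_succ_iff] using hk)
  have hk' := htime k' (by simpa [Nat.lt_succ_iff] using hk')
  set u := a + k * T
  set u' := a + k' * T
  have h1 : g * h ^ (i u - i u') * g⁻¹ = h ^ (j u - j u') := by
    have : g * h ^ i u = h ^ j u * (h ^ (-j u') * g * h ^ i u') := by
      rw [← heq]; group
    rw [sub_eq_add_neg, zpow_add, ← mul_assoc, this]; group
  have h2 : i u = i u' := by linarith [hg _ _ h1]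
  have h3 : dist (γ u) (γ u') = |(k : ℝ) - k'| * T := by
    rw [hγ.2 u ⟨ha.trans hk.1, hk.2.trans hb⟩ u' ⟨ha.trans hk'.1, hk'.2.trans hb⟩]
    rw [show u - u' = ((k : ℝ) - k') * T by simp only [u, u']; ring, abs_mul, abs_of_pos hT0]
  have h4 : (1 : ℝ) ≤ |(k : ℝ) - k'| := by
    have : (1 : ℤ) ≤ |(k : ℤ) - k'| := Int.one_le_abs (by omega)
    exact_mod_cast this
  have h5 : T ≤ |(k : ℝ) - k'| * T := le_mul_of_one_le_left hT0.le h4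
  have h6 := dist_triangle_right (γ u) (γ u') (g • h ^ i u • p)
  have h7 := hi u' hk'
  rw [← h2] at h7
  linarith [hi u hk]

/-- Elements which commensurate `⟨h⟩` move `p` uniformly close to the axis of `h`. -/
theorem exists_infDist_le_of_commensurate (hY : IsGeodesicSpace Y) (hC : 0 ≤ C)
    (hX : IsContractingWith C (powerOrbit h p)) (hl : 0 < l)
    (hq : ∀ m n : ℤ, l⁻¹ * |(m : ℝ) - n| - c ≤ dist (h ^ m • p) (h ^ n • p)) :
    ∃ D : ℝ, ∀ (g : G) (a b : ℤ), 0 < a → g * h ^ a * g⁻¹ = h ^ b →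
      Metric.infDist (g • p) (powerOrbit h p) ≤ D := by
  have hP := isProximinal_powerOrbit h p
  obtain ⟨R, hR0, hR⟩ := exists_dist_le_of_zpow_endpoints hC hX hl hq
  -- The points `g • h ^ (a * k) • p = h ^ (b * k) • g • p` stay within `d = dist (g • p) p` of the
  -- axis. A long geodesic between two of them passes within `R` of `g • p`, and its middle part is
  -- `7 * C`-close to the axis. The size of `d` affects only how long the geodesic must be.
  refine ⟨7 * C + R, fun g a b ha hab => ?_⟩
  have hpow : ∀ k : ℤ, g • h ^ (a * k) • p = h ^ (b * k) • g • p := fun k => by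
    have : g * h ^ (a * k) = h ^ (b * k) * g := by
      rw [zpow_mul, zpow_mul, ← hab, conj_zpow]; group
    rw [← mul_smul, this, mul_smul]
  set d := dist (g • p) p
  have hd : 0 ≤ d := dist_nonneg
  obtain ⟨N, hN⟩ := exists_nat_gt (l * (c + 2 * d + 3 * C + R))
  have hfar : c + 2 * d + 3 * C + R < l⁻¹ * N := by
    rw [lt_inv_mul_iff₀ hl]; linarith
  have ha' : (1 : ℝ) ≤ a := by exact_mod_cast ha
  have hlow : ∀ m n : ℤ, (N : ℝ) ≤ |(m : ℝ) - n| →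
      2 * d + 3 * C + R < dist (h ^ m • p) (h ^ n • p) := fun m n hmn => by
    have : l⁻¹ * N ≤ l⁻¹ * |(m : ℝ) - n| := by gcongr
    linarith [hq m n]
  have haN : (N : ℝ) ≤ a * N := le_mul_of_one_le_left (by positivity) ha'
  obtain ⟨γ, L, hγ, h0, hL⟩ := hY (g • h ^ (a * (-N : ℤ)) • p) (g • h ^ (a * (N : ℤ)) • p)
  obtain ⟨t, ht, htp⟩ := hR _ L (hγ.smul g⁻¹) (a * (-N : ℤ)) (a * (N : ℤ))
    (by rw [mul_neg]; simp; positivity) (by positivity) (by simp [h0]) (by simp [hL])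
  have htp : dist (γ t) (g • p) ≤ R := by
    rwa [← dist_smul g, smul_inv_smul] at htp
  have hproj : ∀ k : ℤ, ∀ r ∈ nearestPoints (powerOrbit h p) (g • h ^ (a * k) • p),
      dist (g • h ^ (a * k) • p) r ≤ d := fun k r hr => by
    refine (hr.2 _ (zpow_smul_mem_powerOrbit h p (b * k))).trans ?_
    rw [hpow, dist_smul]
  obtain ⟨r, hr⟩ := hP (γ 0)
  obtain ⟨r', hr'⟩ := hP (γ L)
  have hr1 : dist (γ 0) r ≤ d := by rw [h0]; exact hproj _ _ (h0 ▸ hr)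
  have hr1' : dist (γ L) r' ≤ d := by rw [hL]; exact hproj _ _ (hL ▸ hr')
  have hends : 2 * d + 3 * C + R < dist (γ 0) (γ L) := by
    rw [h0, hL, dist_smul]
    refine hlow _ _ ?_
    push_cast
    rw [abs_sub_comm, abs_of_nonneg] <;> nlinarith
  have hrr : C < dist r r' := by
    have := dist_triangle4 (γ 0) r r' (γ L)
    rw [dist_comm r' (γ L)] at this
    linarith
  obtain ⟨s, hs, hsr⟩ := hX.exists_dist_le_left hC hP hγ hr hr' hrr
  obtain ⟨s', hs', hsr'⟩ := hX.exists_dist_le_right hC hP hγ hr hr' hrr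
  -- The times `s` and `s'` are within `d + 2 * C` of the two ends, so `t` lies between them.
  have hmid : 2 * d + 3 * C < dist (γ 0) (γ t) ∧ 2 * d + 3 * C < dist (γ t) (γ L) := by
    have h1 := hlow (a * (-N : ℤ)) 0 (by
      push_cast; rw [abs_sub_comm, abs_of_nonneg] <;> nlinarith)
    have h2 := hlow (a * (N : ℤ)) 0 (by push_cast; rw [abs_of_nonneg] <;> nlinarith)
    rw [← dist_smul g, ← h0, zpow_zero, one_smul] at h1
    rw [← dist_smul g, ← hL, zpow_zero, one_smul] at h2
    constructor
    · linarith [dist_triangle (γ 0) (γ t) (g • p)]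
    · linarith [dist_triangle (γ L) (γ t) (g • p), dist_comm (γ L) (γ t)]
  rw [hγ.dist_eq le_rfl ht.1 ht.2, hγ.dist_eq ht.1 ht.2 le_rfl] at hmid
  have hst : s ≤ t := by
    have h1 := dist_triangle_right (γ 0) (γ s) r
    rw [hγ.dist_eq le_rfl hs.1 hs.2] at h1
    linarith
  have hts' : t ≤ s' := by
    have h1 := dist_triangle_right (γ s') (γ L) r'
    rw [hγ.dist_eq hs'.1 hs'.2 le_rfl] at h1
    linarith
  have h1 := hX.infDist_le hP hγ (c := 2 * C) (by linarith) hs.1 hs'.2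
    ((Metric.infDist_le_dist_of_mem hr.1).trans hsr)
    ((Metric.infDist_le_dist_of_mem hr'.1).trans hsr') ⟨hst, hts'⟩
  have h2 := Metric.infDist_le_infDist_add_dist (s := powerOrbit h p) (x := g • p) (y := γ t)
  rw [dist_comm] at h2
  linarith

end Axis

/-! ### The commensurator of a cyclic subgroup -/

/-- The elements `g` such that `g⟨h⟩g⁻¹` and `⟨h⟩` have a common nontrivial power. -/
def cyclicCommensurator {G : Type*} [Group G] (h : G) (hh : ∀ n : ℤ, h ^ n = 1 → n = 0) :
    Subgroup G where
  carrier := {g | ∃ a b : ℤ, a ≠ 0 ∧ g * h ^ a * g⁻¹ = h ^ b}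
  one_mem' := ⟨1, 1, one_ne_zero, by simp⟩
  mul_mem' := by
    rintro g k ⟨a, b, ha, hab⟩ ⟨a', b', ha', hab'⟩
    refine ⟨a' * a, b * b', mul_ne_zero ha' ha, ?_⟩
    have : g * k * h ^ (a' * a) * (g * k)⁻¹ = g * (k * h ^ a' * k⁻¹) ^ a * g⁻¹ := by
      rw [conj_zpow, ← zpow_mul]; group
    rw [this, hab', ← zpow_mul, mul_comm b' a, zpow_mul, ← conj_zpow, hab, ← zpow_mul]
  inv_mem' := by
    rintro g ⟨a, b, ha, hab⟩
    refine ⟨b, a, fun hb => ha (hh a ?_), ?_⟩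
    · rw [hb, zpow_zero] at hab
      have : h ^ a = g⁻¹ * (g * h ^ a * g⁻¹) * g := by group
      rw [this, hab]; group
    · rw [← hab]; group

/-- Otherwise `E` has at most two left cosets. Since `E` is covered by finitely many cosets of the
infinite cyclic group generated by `h`, that group would have finite index in `G`. -/
theorem exists_three_of_isNonElementary {G : Type*} [Group G] (hG : IsNonElementary G) {h : G}
    (hh : ∀ n : ℤ, h ^ n = 1 → n = 0) {E : Subgroup G} {S : Set G} (hS : S.Finite)
    (hE : ∀ g ∈ E, ∃ n : ℤ, h ^ n * g ∈ S) :
    ∃ f : Fin 3 → G, ∀ i j, i ≠ j → (f i)⁻¹ * f j ∉ E := by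
  by_contra! hno
  obtain ⟨T, hT, hTE⟩ : ∃ T : Set G, T.Finite ∧ ∀ g, ∃ t ∈ T, t⁻¹ * g ∈ E := by
    by_cases htop : ∀ g, g ∈ E
    · exact ⟨{1}, Set.finite_singleton 1, fun g => ⟨1, rfl, htop _⟩⟩
    push Not at htop
    obtain ⟨k, hk⟩ := htop
    refine ⟨{1, k}, by simp, fun g => ?_⟩
    by_contra! hg
    have h1 := hg 1 (by simp)
    have h2 := hg k (by simp)
    rw [inv_one, one_mul] at h1
    obtain ⟨i, j, hij, hmem⟩ := hno ![1, k, g]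
    have h1' : g⁻¹ ∉ E := fun h' => h1 (by simpa using E.inv_mem h')
    have hk' : k⁻¹ ∉ E := fun h' => hk (by simpa using E.inv_mem h')
    have h2' : g⁻¹ * k ∉ E := fun h' => h2 (by simpa using E.inv_mem h')
    fin_cases i <;> fin_cases j <;> simp_all
  let φ := zpowersHom G h
  have hφ : Function.Injective φ := (injective_iff_map_eq_one φ).2 fun n hn => by
    have := hh n.toAdd (by simpa [φ, zpowersHom_apply] using hn)
    exact this
  have hfin : Finite (G ⧸ φ.range) := by
    have := (hT.image2 (fun t s : G => ((t * s⁻¹ : G) : G ⧸ φ.range)) hS)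
    refine Set.finite_univ_iff.1 (this.subset ?_)
    rintro x -
    obtain ⟨g, rfl⟩ := QuotientGroup.mk_surjective x
    obtain ⟨t, ht, hg⟩ := hTE g
    -- Passing to the inverse turns right cosets of `⟨h⟩` into left ones.
    obtain ⟨n, hn⟩ := hE _ (E.inv_mem hg)
    refine ⟨t, ht, _, hn, ?_⟩
    rw [QuotientGroup.eq]
    refine ⟨Multiplicative.ofAdd n, ?_⟩
    simp only [φ, zpowersHom_apply, toAdd_ofAdd]
    group
  exact hG ⟨φ.range, Subgroup.finiteIndex_of_finite_quotient,
    Or.inl ⟨(MonoidHom.ofInjective hφ).symm⟩⟩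

/-! ### The extension lemma -/

section Extension

variable {G Y : Type*} [Group G] [MetricSpace Y] [ProperSpace Y] [MulAction G Y]
  [IsIsometricSMul G Y] [ProperlyDiscontinuousSMul G Y]

/-- Extension lemma: any two points `x`, `y` can be joined through `o` after moving `y` by an element
of a fixed finite set. Among three translates of a contracting axis with pairwise bounded projections,
each point projects far from the base point to at most one; a large power of the contracting element
along one that is good for both points is the required element. -/
theorem exists_finite_extension (hY : IsGeodesicSpace Y) (hG : IsNonElementary G)
    (hcontr : ∃ h : G, IsContractingElement (Y := Y) h) (o : Y) :
    ∃ (F : Set G) (R : ℝ), F.Finite ∧ ∀ x y : Y, ∃ f ∈ F, ∀ (γ : ℝ → Y) (L : ℝ),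
      IsGeodesicSegment γ L → γ 0 = x → γ L = f • y → ∃ t ∈ Set.Icc 0 L, dist (γ t) o ≤ R := by
  obtain ⟨h, p, ⟨C, hC1, hX⟩, l, c, hl1, hc, hq⟩ := hcontr
  have hC : 0 ≤ C := by linarith
  have hl : 0 < l := by linarith
  change IsContractingWith C (powerOrbit h p) at hX
  have hqi : ∀ m n : ℤ, l⁻¹ * |(m : ℝ) - n| - c ≤ dist (h ^ m • p) (h ^ n • p) :=
    fun m n => (hq m n).1
  have hP := isProximinal_powerOrbit h p
  have hfar : ∀ r : ℝ, ∃ N : ℕ, ∀ n : ℤ, (N : ℤ) ≤ |n| → r < dist p (h ^ n • p) := fun r => by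
    obtain ⟨N, hN⟩ := exists_nat_gt (l * (r + c))
    refine ⟨N, fun n hn => ?_⟩
    have h1 := hqi 0 n
    rw [zpow_zero, one_smul] at h1
    have h2 : (N : ℝ) ≤ |(n : ℝ)| := by exact_mod_cast hn
    have h3 : r + c < l⁻¹ * |(n : ℝ)| := by rw [lt_inv_mul_iff₀ hl]; linarith
    simp at h1
    linarith
  have hh : ∀ n : ℤ, h ^ n = 1 → n = 0 := by
    intro n hn
    by_contra hne
    obtain ⟨N, hN⟩ := hfar 0
    have := hN (n * N) (by
      rw [abs_mul, Nat.abs_cast]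
      exact le_mul_of_one_le_left (by positivity) (Int.one_le_abs hne))
    rw [zpow_mul, hn, one_zpow, one_smul, dist_self] at this
    exact lt_irrefl _ this
  obtain ⟨D, hD⟩ := exists_infDist_le_of_commensurate hY hC hX hl hqi
  -- Modulo powers of `h`, a commensurating element moves `p` by at most `D + 1`, which leaves
  -- finitely many. Distinct cosets of the commensurator give axes with mutually bounded
  -- projections.
  obtain ⟨f, hf⟩ := exists_three_of_isNonElementary hG hh (E := cyclicCommensurator h hh)
    (finite_setOf_dist_smul_le (G := G) p p (D + 1)) (by
      rintro g ⟨a, b, ha, hab⟩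
      have : Metric.infDist (g • p) (powerOrbit h p) < D + 1 := by
        rcases lt_or_gt_of_ne ha with ha | ha
        · have := hD g (-a) (-b) (by omega) (by
            rw [zpow_neg, zpow_neg, ← hab]; group)
          linarith
        · linarith [hD g a b ha hab]
      obtain ⟨_, ⟨n, rfl⟩, hn⟩ := (Metric.infDist_lt_iff ⟨p, mem_powerOrbit_self h p⟩).1 this
      refine ⟨-n, ?_⟩
      rw [Set.mem_ofPred_eq, ← dist_smul (h ^ n), mul_smul, zpow_neg, smul_inv_smul, dist_comm]
      exact hn.le)
  have hproj : ∀ i j, ∃ B : ℝ, i ≠ j → ∀ x ∈ f i • powerOrbit h p,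
      ∀ r ∈ nearestPoints (f j • powerOrbit h p) x, dist r (f j • p) ≤ B := by
    intro i j
    by_cases hij : i = j
    · exact ⟨0, fun h' => absurd hij h'⟩
    obtain ⟨B, hB⟩ := exists_bound_proj_translate hY hC hX (g := (f j)⁻¹ * f i) (by
      intro a b hab
      by_contra ha
      exact hf j i (Ne.symm hij) ⟨a, b, ha, hab⟩)
    refine ⟨B, fun _ x hx r hr => ?_⟩
    have := hB ((f j)⁻¹ • x) (by
      rw [mul_smul]; exact Set.smul_mem_smul_set hx) _ (inv_smul_mem_nearestPoints hr)
    rwa [← dist_smul (f j), smul_inv_smul] at this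
  choose B hB using hproj
  obtain ⟨τ, hτ⟩ : ∃ τ : ℝ, ∀ i j, B i j + 6 * C + 2 * dist (f i • p) (f j • p) ≤ τ := by
    obtain ⟨τ, hτ⟩ := (Set.finite_range fun ij : Fin 3 × Fin 3 =>
      B ij.1 ij.2 + 6 * C + 2 * dist (f ij.1 • p) (f ij.2 • p)).bddAbove
    exact ⟨τ, fun i j => hτ ⟨(i, j), rfl⟩⟩
  let bad : Fin 3 → Y → Prop := fun i y =>
    ∃ q ∈ nearestPoints (f i • powerOrbit h p) y, τ < dist q (f i • p)
  have hbad : ∀ y i j, bad i y → bad j y → i = j := by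
    rintro y i j ⟨q, hq, hqτ⟩ ⟨r, hr, hrτ⟩
    by_contra hij
    have := (hX.smul (f i)).behrstock (hX.smul (f j)) hC (hP.smul _) (hP.smul _) hY
      (Set.smul_mem_smul_set (mem_powerOrbit_self h p)) (hB i j hij) hq hr (by
        have := hτ i j
        linarith [dist_nonneg (x := f i • p) (y := f j • p)])
    linarith [hτ i j]
  -- Both `x` and `y` project within `τ` of the base point of the chosen axis, so moving `y` along
  -- it by more than `2 * τ + C` separates the projections by more than `C`.
  obtain ⟨N, hN⟩ := hfar (2 * τ + C)
  let F : Fin 3 → G := fun i => f i * h ^ N * (f i)⁻¹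
  obtain ⟨R, hR⟩ := (Set.finite_range fun i => dist (f i • p) o).bddAbove
  refine ⟨Set.range F, 2 * C + τ + R, Set.finite_range F, fun x y => ?_⟩
  obtain ⟨i, hix, hiy⟩ : ∃ i, ¬ bad i x ∧ ¬ bad i y := by
    by_contra! hall
    by_cases h0 : bad 0 x
    · have h1 := hall 1 fun h' => by simpa using hbad x _ _ h0 h'
      have h2 := hall 2 fun h' => by simpa using hbad x _ _ h0 h'
      simpa using hbad y _ _ h1 h2
    · have h1 := hall 0 h0
      by_cases h2 : bad 1 x
      · have h3 := hall 2 fun h' => by simpa using hbad x _ _ h2 h'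
        simpa using hbad y _ _ h1 h3
      · simpa using hbad y _ _ h1 (hall 1 h2)
  refine ⟨F i, ⟨i, rfl⟩, fun γ L hγ h0 hL => ?_⟩
  obtain ⟨q, hq⟩ := hP.smul (f i) x
  obtain ⟨r, hr⟩ := hP.smul (f i) y
  have hqτ : dist q (f i • p) ≤ τ := not_lt.1 fun h' => hix ⟨q, hq, h'⟩
  have hrτ : dist r (f i • p) ≤ τ := not_lt.1 fun h' => hiy ⟨r, hr, h'⟩
  have hFX : F i • f i • powerOrbit h p = f i • powerOrbit h p := by
    simp only [F, mul_smul, inv_smul_smul]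
    rw [← zpow_natCast, zpow_smul_powerOrbit]
  have hr' : F i • r ∈ nearestPoints (f i • powerOrbit h p) (F i • y) := by
    have := smul_mem_nearestPoints_smul (F i) hr
    rwa [hFX] at this
  have hbase : 2 * τ + C < dist (f i • p) (F i • f i • p) := by
    simp only [F, mul_smul, inv_smul_smul, dist_smul]
    have := hN N (by simp)
    rwa [zpow_natCast] at this
  have hqr : C < dist q (F i • r) := by
    have := dist_triangle4 (f i • p) q (F i • r) (F i • f i • p)
    rw [dist_smul, dist_comm (f i • p) q] at this
    linarith
  obtain ⟨t, ht, htq⟩ := (hX.smul (f i)).exists_dist_le_left hC (hP.smul _) hγ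
    (h0 ▸ hq) (hL ▸ hr') hqr
  refine ⟨t, ht, ?_⟩
  have hRi : dist (f i • p) o ≤ R := hR ⟨i, rfl⟩
  linarith [dist_triangle4 (γ t) q (f i • p) o]

end Extension

/-! ### Critical exponents of counting functions -/

section Count

variable {G Y : Type*} [Group G] [MetricSpace Y] [MulAction G Y]

/-- The number of elements of `Γ` in the orbit ball of radius `r`. -/
noncomputable def ballCount (o : Y) (Γ : Set G) (r : ℝ) : ℕ := (orbitBall G o r ∩ Γ).ncard

theorem one_mem_orbitBall (o : Y) {r : ℝ} (hr : 0 ≤ r) : (1 : G) ∈ orbitBall G o r := by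
  simpa [orbitBall] using hr

variable [ProperSpace Y] [ProperlyDiscontinuousSMul G Y]

theorem orbitBall_finite (o : Y) (r : ℝ) : (orbitBall G o r).Finite :=
  finite_setOf_dist_smul_le o o r

theorem orbitAnnulus_finite (o : Y) (r Δ : ℝ) : (orbitAnnulus G o r Δ).Finite :=
  (orbitBall_finite (G := G) o (r + Δ)).subset fun g hg => by
    have := (abs_le.1 (show |dist o (g • o) - r| ≤ Δ from hg)).2
    show dist o (g • o) ≤ r + Δ
    linarith

theorem ballCount_mono (o : Y) (Γ : Set G) {r r' : ℝ} (h : r ≤ r') :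
    ballCount o Γ r ≤ ballCount o Γ r' :=
  Set.ncard_le_ncard (Set.inter_subset_inter_left _ fun g hg =>
      show dist o (g • o) ≤ r' from le_trans (show dist o (g • o) ≤ r from hg) h)
    ((orbitBall_finite o r').subset Set.inter_subset_left)

variable {o : Y} {Γ : Set G}

theorem one_le_ballCount (h1 : 1 ∈ Γ) {r : ℝ} (hr : 0 ≤ r) : 1 ≤ ballCount o Γ r :=
  (Set.ncard_pos ((orbitBall_finite o r).subset Set.inter_subset_left)).2
    ⟨1, one_mem_orbitBall o hr, h1⟩

/-- Properness makes the count finite and `1 ∈ Γ` makes it positive, so the extended logarithm is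
real. -/
theorem growthQuotient_eq (h1 : 1 ∈ Γ) (n : ℕ) :
    growthQuotient o Γ n = ((Real.log (ballCount o Γ n) / n : ℝ) : EReal) := by
  have hfin : (orbitBall G o n ∩ Γ).Finite := (orbitBall_finite o n).subset Set.inter_subset_left
  have hpos : (0 : ℝ) < ballCount o Γ n := by
    exact_mod_cast one_le_ballCount (o := o) h1 (Nat.cast_nonneg n)
  rw [growthQuotient, ← hfin.cast_ncard_eq, EReal.coe_div, ← ENNReal.log_ofReal_of_pos hpos,
    EReal.coe_coe_eq_natCast]
  simp [ballCount]

theorem tendsto_const_div_add (a w : ℝ) :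
    Tendsto (fun n : ℕ => ((a / n + w : ℝ) : EReal)) atTop (𝓝 (w : EReal)) := by
  refine (continuous_coe_real_ereal.tendsto w).comp ?_
  simpa using (tendsto_const_div_atTop_nhds_zero_nat a).add_const w

theorem criticalExponent_le_of_ballCount_le (h1 : 1 ∈ Γ) {A w : ℝ}
    (h : ∀ n : ℕ, (ballCount o Γ n : ℝ) ≤ A * Real.exp (w * n)) :
    criticalExponent o Γ ≤ w := by
  rw [← (tendsto_const_div_add (Real.log A) w).limsup_eq]
  refine limsup_le_limsup ?_
  filter_upwards [eventually_ge_atTop 1] with n hn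
  have hn' : (0 : ℝ) < n := by exact_mod_cast hn
  rw [growthQuotient_eq h1, EReal.coe_le_coe_iff]
  have hpos : (1 : ℝ) ≤ ballCount o Γ n := by exact_mod_cast one_le_ballCount h1 hn'.le
  have hA : 0 < A := by
    by_contra! hA
    have := mul_nonpos_of_nonpos_of_nonneg hA (Real.exp_pos (w * n)).le
    linarith [h n]
  have := Real.log_le_log (by linarith) (h n)
  rw [Real.log_mul hA.ne' (Real.exp_pos _).ne', Real.log_exp] at this
  rw [div_le_iff₀ hn', add_mul, div_mul_cancel₀ _ hn'.ne']
  exact this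

theorem le_liminf_growthQuotient (h1 : 1 ∈ Γ) {A w : ℝ} (hA : 0 < A)
    (h : ∀ n : ℕ, A * Real.exp (w * n) ≤ ballCount o Γ n) :
    (w : EReal) ≤ liminf (growthQuotient o Γ) atTop := by
  rw [← (tendsto_const_div_add (Real.log A) w).liminf_eq]
  refine liminf_le_liminf ?_
  filter_upwards [eventually_ge_atTop 1] with n hn
  have hn' : (0 : ℝ) < n := by exact_mod_cast hn
  rw [growthQuotient_eq h1, EReal.coe_le_coe_iff]
  have := Real.log_le_log (mul_pos hA (Real.exp_pos _)) (h n)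
  rw [Real.log_mul hA.ne' (Real.exp_pos _).ne', Real.log_exp] at this
  rw [le_div_iff₀ hn', add_mul, div_mul_cancel₀ _ hn'.ne']
  exact this

theorem zero_le_criticalExponent (h1 : 1 ∈ Γ) : 0 ≤ criticalExponent o Γ :=
  (le_liminf_growthQuotient (o := o) h1 (w := 0) one_pos fun n => by
    simpa using one_le_ballCount (o := o) h1 (Nat.cast_nonneg n)).trans
    (liminf_le_limsup)

theorem exists_ballCount_le_of_criticalExponent_lt (h1 : 1 ∈ Γ) {w : ℝ}
    (h : criticalExponent o Γ < w) :
    ∃ A : ℝ, 0 < A ∧ ∀ n : ℕ, (ballCount o Γ n : ℝ) ≤ A * Real.exp (w * n) := by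
  obtain ⟨N, hN⟩ := eventually_atTop.1 ((eventually_lt_of_limsup_lt h).and (eventually_ge_atTop 1))
  have hw : 0 ≤ w := by
    have := (zero_le_criticalExponent (o := o) h1).trans h.le
    exact_mod_cast this
  refine ⟨ballCount o Γ N + 1, by positivity, fun n => ?_⟩
  have hexp : 1 ≤ Real.exp (w * n) := Real.one_le_exp (by positivity)
  rcases le_total n N with hn | hn
  · have : (ballCount o Γ n : ℝ) ≤ ballCount o Γ N := by
      exact_mod_cast ballCount_mono o Γ (by exact_mod_cast hn)
    nlinarith [Nat.cast_nonneg (α := ℝ) (ballCount o Γ N)]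
  · obtain ⟨h2, h3⟩ := hN n hn
    have hn' : (0 : ℝ) < n := by exact_mod_cast h3
    rw [growthQuotient_eq h1, EReal.coe_lt_coe_iff, div_lt_iff₀ hn'] at h2
    have hpos : (1 : ℝ) ≤ ballCount o Γ n := by exact_mod_cast one_le_ballCount h1 hn'.le
    rw [Real.log_lt_iff_lt_exp (by linarith)] at h2
    nlinarith [Nat.cast_nonneg (α := ℝ) (ballCount o Γ N)]

theorem ballCount_succ_le (o : Y) (n : ℕ) :
    (ballCount o (Set.univ : Set G) (n + 1 : ℕ) : ℝ) ≤
      ballCount o (Set.univ : Set G) n + (orbitAnnulus G o (n + 1 : ℕ) 1).ncard := by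
  have : orbitBall G o (n + 1 : ℕ) ⊆ orbitBall G o n ∪ orbitAnnulus G o (n + 1 : ℕ) 1 := by
    intro g hg
    have hg : dist o (g • o) ≤ (n + 1 : ℕ) := hg
    by_cases h : dist o (g • o) ≤ n
    · exact Or.inl h
    · refine Or.inr (show |dist o (g • o) - (n + 1 : ℕ)| ≤ 1 from abs_le.2 ?_)
      push_cast at hg ⊢
      constructor <;> linarith
  have h1 := (Set.ncard_le_ncard this ((orbitBall_finite o _).union (orbitAnnulus_finite o _ _))).trans
    (Set.ncard_union_le _ _)
  simp only [ballCount, Set.inter_univ]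
  exact_mod_cast h1

end Count

/-- Summation of a sequence whose increments are bounded by a geometric progression. -/
theorem le_of_increment_le_exp {S : ℕ → ℝ} {A w : ℝ} (hw : 0 < w) (hA : 0 ≤ A) (h0 : S 0 ≤ A)
    (h : ∀ n, S (n + 1) ≤ S n + A * Real.exp (w * (n + 1 : ℕ))) (n : ℕ) :
    S n ≤ A / (1 - Real.exp (-w)) * Real.exp (w * n) := by
  have hd : 0 < 1 - Real.exp (-w) := by
    have := Real.exp_lt_exp.2 (neg_neg_of_pos hw)
    rw [Real.exp_zero] at this
    linarith
  set D := A / (1 - Real.exp (-w)) with hD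
  -- This makes `D * exp (w * n)` grow by exactly the allowed increment.
  have hAD : A = D * (1 - Real.exp (-w)) := by rw [hD, div_mul_cancel₀ _ hd.ne']
  have hD0 : 0 ≤ D := div_nonneg hA hd.le
  induction n with
  | zero =>
    have := mul_nonneg hD0 (Real.exp_pos (-w)).le
    simp only [Nat.cast_zero, mul_zero, Real.exp_zero, mul_one]
    linarith
  | succ n ih =>
    have h1 : Real.exp (w * n) = Real.exp (-w) * Real.exp (w * (n + 1 : ℕ)) := by
      rw [← Real.exp_add]; congr 1; push_cast; ring
    have := h n
    rw [h1] at ih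
    rw [hAD] at this
    linarith

/-! ### Upper bounds for annuli -/

section Upper

variable {G Y : Type*} [Group G] [MetricSpace Y] [ProperSpace Y] [MulAction G Y]
  [IsIsometricSMul G Y] [ProperlyDiscontinuousSMul G Y]

/-- Counting with the extension lemma: the map `(g, k) ↦ g f k` is boundedly many to one. -/
theorem exists_annulus_mul_ballCount_le (hY : IsGeodesicSpace Y) (hG : IsNonElementary G)
    (hcontr : ∃ h : G, IsContractingElement (Y := Y) h) (o : Y) (Δ : ℝ) :
    ∃ A : ℝ, 0 < A ∧ ∃ K : ℕ, 0 < K ∧ ∀ n m : ℕ,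
      ((orbitAnnulus G o n Δ).ncard : ℝ) * ballCount o (Set.univ : Set G) m ≤
        A * ballCount o (Set.univ : Set G) (m + n + K : ℕ) := by
  classical
  obtain ⟨F, R, hF, hext⟩ := exists_finite_extension hY hG hcontr o
  choose ext hextF hext using hext
  obtain ⟨M, hM⟩ := (hF.image fun f => dist o (f • o)).bddAbove
  -- If `g` and `g₀` lead to the same product `z`, then `g • o` and `g₀ • o` are `R`-close to one
  -- geodesic from `o` to `z • o`, at times within `R + Δ` of `n`. So `g₀⁻¹ * g` lies in this finite
  -- set; together with the connecting element it determines `g`, and then `k` by cancellation.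
  have hB := finite_setOf_dist_smul_le (G := G) o o (4 * R + 2 * Δ)
  obtain ⟨K, hK⟩ := exists_nat_ge (Δ + M)
  refine ⟨(hB.toFinset ×ˢ hF.toFinset).card + 1, by positivity, K + 1, by positivity, fun n m => ?_⟩
  have hAf := orbitAnnulus_finite (G := G) o n Δ
  have hNf := orbitBall_finite (G := G) o m
  have hTf := orbitBall_finite (G := G) o (m + n + (K + 1) : ℕ)
  let e : G × G → G := fun x => ext (x.1⁻¹ • o) (x.2 • o)
  let φ : G × G → G := fun x => x.1 * e x * x.2
  have key := Finset.card_le_mul_card_image (f := φ) (hAf.toFinset ×ˢ hNf.toFinset)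
    (hB.toFinset ×ˢ hF.toFinset).card (by
      intro z hz
      obtain ⟨⟨g₀, k₀⟩, hgk₀, hφ₀⟩ := Finset.mem_image.1 hz
      refine Finset.card_le_card_of_injOn (fun x => (g₀⁻¹ * x.1, e x)) ?_ ?_
      · rintro ⟨g, k⟩ hgk
        have hgk := Finset.mem_filter.1 hgk
        simp only [Finset.mem_product, Set.Finite.mem_toFinset] at hgk₀ hgk
        simp only [Finset.coe_product, Set.Finite.coe_toFinset, Set.mem_prod]
        refine ⟨?_, hextF _ _⟩
        obtain ⟨γ, L, hγ, h0, hL⟩ := hY o (z • o)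
        have near : ∀ g k : G, φ (g, k) = z → ∃ t ∈ Set.Icc 0 L, dist (γ t) (g • o) ≤ R := by
          intro g k hgk
          obtain ⟨t, ht, h⟩ := hext (g⁻¹ • o) (k • o) _ L (hγ.smul g⁻¹) (by rw [h0]) (by
            rw [hL, ← hgk]; simp only [φ, e, mul_smul, inv_smul_smul])
          exact ⟨t, ht, by rwa [← dist_smul g, smul_inv_smul] at h⟩
        obtain ⟨s, hs, hs'⟩ := near g₀ k₀ hφ₀
        obtain ⟨t, ht, ht'⟩ := near g k hgk.2
        have e1 := abs_le.1 (show |dist o (g₀ • o) - n| ≤ Δ from hgk₀.1)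
        have e2 := abs_le.1 (show |dist o (g • o) - n| ≤ Δ from hgk.1.1)
        have es := hγ.dist_eq le_rfl hs.1 hs.2
        have et := hγ.dist_eq le_rfl ht.1 ht.2
        rw [h0] at es et
        have d1 := dist_triangle o (γ s) (g₀ • o)
        have d2 := dist_triangle_right o (γ s) (g₀ • o)
        have d3 := dist_triangle o (γ t) (g • o)
        have d4 := dist_triangle_right o (γ t) (g • o)
        have hst : dist (γ s) (γ t) ≤ 2 * R + 2 * Δ := by
          rw [hγ.2 s hs t ht, abs_le]
          constructor <;> linarith [e1.1, e1.2, e2.1, e2.2]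
        have d5 := dist_triangle4 (g₀ • o) (γ s) (γ t) (g • o)
        rw [dist_comm (g₀ • o) (γ s)] at d5
        rw [Set.mem_ofPred_eq, ← dist_smul g₀, mul_smul, smul_inv_smul]
        linarith
      · rintro ⟨g, k⟩ hgk ⟨g', k'⟩ hgk' heq
        have h1 : φ (g, k) = φ (g', k') :=
          ((Finset.mem_filter.1 hgk).2).trans ((Finset.mem_filter.1 hgk').2).symm
        simp only [Prod.mk.injEq, mul_right_inj] at heq
        obtain ⟨rfl, he⟩ := heq
        simp only [φ] at h1
        rw [he] at h1
        rw [mul_left_cancel h1])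
  have himg : ((hAf.toFinset ×ˢ hNf.toFinset).image φ).card ≤ hTf.toFinset.card := by
    refine Finset.card_le_card fun z hz => ?_
    obtain ⟨⟨g, k⟩, hgk, rfl⟩ := Finset.mem_image.1 hz
    simp only [Finset.mem_product, Set.Finite.mem_toFinset] at hgk
    rw [Set.Finite.mem_toFinset]
    have e1 := abs_le.1 (show |dist o (g • o) - n| ≤ Δ from hgk.1)
    have e2 : dist o (k • o) ≤ m := hgk.2
    have e3 : dist o (e (g, k) • o) ≤ M := hM ⟨_, hextF _ _, rfl⟩
    show dist o ((g * e (g, k) * k) • o) ≤ (m + n + (K + 1) : ℕ)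
    have d := dist_triangle4 o (g • o) ((g * e (g, k)) • o) ((g * e (g, k) * k) • o)
    rw [mul_smul g (e (g, k)) o, dist_smul, ← mul_smul, mul_smul (g * e (g, k)) k o, dist_smul] at d
    rw [mul_smul (g * e (g, k)) k o]
    push_cast
    linarith [e1.2]
  rw [Finset.card_product, ← Set.ncard_eq_toFinset_card _ hAf,
    ← Set.ncard_eq_toFinset_card _ hNf] at key
  rw [← Set.ncard_eq_toFinset_card _ hTf] at himg
  simp only [ballCount, Set.inter_univ]
  have := key.trans (Nat.mul_le_mul_left _ himg)
  have h2 : ((orbitAnnulus G o n Δ).ncard : ℝ) * (orbitBall G o m).ncard ≤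
      (hB.toFinset ×ˢ hF.toFinset).card * (orbitBall G o (m + n + (K + 1) : ℕ)).ncard := by
    exact_mod_cast this
  linarith [Nat.cast_nonneg (α := ℝ) (orbitBall G o (m + n + (K + 1) : ℕ)).ncard]

/-- One large annulus suffices: for fixed `n`, each application of the counting inequality enlarges
the radius by `n + K` and multiplies the ball count by at least `exp (w * (n + K))`. -/
theorem exists_le_liminf_of_annulus_large (hY : IsGeodesicSpace Y) (hG : IsNonElementary G)
    (hcontr : ∃ h : G, IsContractingElement (Y := Y) h) (o : Y) (Δ : ℝ) :
    ∃ A : ℝ, 0 < A ∧ ∀ (w : ℝ) (n : ℕ), 0 ≤ w →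
      A * Real.exp (w * (n + A)) ≤ (orbitAnnulus G o n Δ).ncard →
      (w : EReal) ≤ liminf (growthQuotient o (Set.univ : Set G)) atTop := by
  obtain ⟨A, hA, K, hK, h⟩ := exists_annulus_mul_ballCount_le hY hG hcontr o Δ
  refine ⟨A + K, by positivity, fun w n hw hn => ?_⟩
  set q := n + K with hq
  have hA' : A * Real.exp (w * q) ≤ (orbitAnnulus G o n Δ).ncard := by
    refine le_trans ?_ hn
    gcongr
    · linarith [Nat.cast_nonneg (α := ℝ) K]
    · rw [hq]; push_cast; linarith
  have hiter : ∀ k : ℕ, Real.exp (w * q) ^ k ≤ ballCount o (Set.univ : Set G) (k * q : ℕ) := by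
    intro k
    induction k with
    | zero => simpa using one_le_ballCount (o := o) (Set.mem_univ (1 : G)) le_rfl
    | succ k ih =>
      have h1 := h n (k * q)
      rw [show k * q + n + K = (k + 1) * q by rw [hq]; ring] at h1
      have h2 : A * Real.exp (w * q) * Real.exp (w * q) ^ k ≤
          A * ballCount o (Set.univ : Set G) ((k + 1) * q : ℕ) := by
        refine le_trans ?_ h1
        gcongr
      rw [mul_assoc, ← pow_succ'] at h2
      exact le_of_mul_le_mul_left h2 hA
  -- The factor `exp (-(w * q))` pays for rounding `m` down to a multiple of `q`.
  refine le_liminf_growthQuotient (Set.mem_univ _) (Real.exp_pos (-(w * q))) fun m => ?_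
  have hq0 : 0 < q := by omega
  have h1 := hiter (m / q)
  have h2 : (ballCount o (Set.univ : Set G) (m / q * q : ℕ) : ℝ) ≤
      ballCount o (Set.univ : Set G) m := by
    exact_mod_cast ballCount_mono o _ (by exact_mod_cast Nat.div_mul_le_self m q)
  refine le_trans ?_ (h1.trans h2)
  rw [← Real.exp_add, ← Real.exp_nat_mul]
  refine Real.exp_le_exp.2 ?_
  have h3 : (m : ℝ) ≤ (m / q : ℕ) * q + q := by
    have := Nat.div_add_mod m q
    have h4 := Nat.mod_lt m hq0
    have : m ≤ m / q * q + q := by rw [mul_comm]; omega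
    exact_mod_cast this
  nlinarith

theorem criticalExponent_le_liminf (hY : IsGeodesicSpace Y) (hG : IsNonElementary G)
    (hcontr : ∃ h : G, IsContractingElement (Y := Y) h) (o : Y) :
    criticalExponent o (Set.univ : Set G) ≤ liminf (growthQuotient o (Set.univ : Set G)) atTop := by
  obtain ⟨A, hA, h⟩ := exists_le_liminf_of_annulus_large hY hG hcontr o 1
  refine le_of_forall_lt fun x hx => ?_
  obtain ⟨w, hxw, hw⟩ := EReal.lt_iff_exists_real_btwn.1 hx
  refine hxw.trans_le ?_
  rcases le_or_gt w 0 with hw0 | hw0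
  · refine le_trans (b := ((0 : ℝ) : EReal)) (by exact_mod_cast hw0) ?_
    exact le_liminf_growthQuotient (Set.mem_univ _) one_pos fun n => by
      simpa using one_le_ballCount (o := o) (Set.mem_univ (1 : G)) (Nat.cast_nonneg n)
  by_contra hlim
  -- If the liminf is below `w`, every annulus is small; summing annuli then gives critical exponent
  -- at most `w`, a contradiction.
  have hsmall : ∀ n : ℕ, ((orbitAnnulus G o n 1).ncard : ℝ) ≤ A * Real.exp (w * (n + A)) :=
    fun n => (not_le.1 fun h' => hlim (h w n hw0.le h')).le
  refine hw.not_ge (criticalExponent_le_of_ballCount_le (Set.mem_univ _)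
    (le_of_increment_le_exp (S := fun n => (ballCount o (Set.univ : Set G) n : ℝ)) hw0
      (A := A * Real.exp (w * A) + ballCount o (Set.univ : Set G) (0 : ℕ)) (by positivity)
      (by linarith [mul_pos hA (Real.exp_pos (w * A))]) fun n => ?_))
  refine (ballCount_succ_le o n).trans (add_le_add_right ((hsmall _).trans ?_) _)
  rw [mul_add, Real.exp_add, add_mul]
  have : 0 ≤ (ballCount o (Set.univ : Set G) (0 : ℕ) : ℝ) * Real.exp (w * (n + 1 : ℕ)) := by
    positivity
  linarith

theorem exists_annulus_le_exp (hY : IsGeodesicSpace Y) (hG : IsNonElementary G)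
    (hcontr : ∃ h : G, IsContractingElement (Y := Y) h) (o : Y) (Δ : ℝ) {ω : ℝ}
    (hω : criticalExponent o (Set.univ : Set G) = ω) :
    ∃ A : ℝ, 0 < A ∧ ∀ n : ℕ, ((orbitAnnulus G o n Δ).ncard : ℝ) ≤ A * Real.exp (ω * n) := by
  obtain ⟨A, hA, h⟩ := exists_le_liminf_of_annulus_large hY hG hcontr o Δ
  have hω0 : 0 ≤ ω := by
    have := zero_le_criticalExponent (o := o) (Set.mem_univ (1 : G))
    rw [hω] at this
    exact_mod_cast this
  refine ⟨A * Real.exp (ω * A), by positivity, fun n => ?_⟩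
  by_contra! hlt
  have hnA : 0 < n + A := by positivity
  rw [mul_assoc, ← Real.exp_add, add_comm, ← mul_add, ← lt_div_iff₀' hA] at hlt
  have hpos : 0 < ((orbitAnnulus G o n Δ).ncard : ℝ) / A := (Real.exp_pos _).trans hlt
  -- The rate `w` solves `A * exp (w * (n + A)) = ♯A(o, n, Δ)`. It would exceed `ω` and yet be at
  -- most the liminf.
  set w := Real.log (((orbitAnnulus G o n Δ).ncard : ℝ) / A) / (n + A) with hw
  have hωw : ω < w := by
    rw [hw, lt_div_iff₀ hnA, Real.lt_log_iff_exp_lt hpos]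
    exact hlt
  have := h w n (hω0.trans hωw.le) (by
    rw [hw, div_mul_cancel₀ _ hnA.ne', Real.exp_log hpos, mul_div_cancel₀ _ hA.ne'])
  have h2 := this.trans liminf_le_limsup
  change _ ≤ criticalExponent o (Set.univ : Set G) at h2
  rw [hω, EReal.coe_le_coe_iff] at h2
  linarith

end Upper

/-! ### Partial Poincaré series -/

section Poincare

variable {G Y : Type*} [Group G] [MetricSpace Y] [ProperSpace Y] [MulAction G Y]
  [ProperlyDiscontinuousSMul G Y] {o : Y} {Γ : Set G} {σ : ℝ}

/-- The elements of `Γ` in the orbit ball of radius `r`, as a finset. -/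
noncomputable def ballFinset (o : Y) (Γ : Set G) (r : ℝ) : Finset G :=
  ((orbitBall_finite o r).subset (Set.inter_subset_left (t := Γ))).toFinset

theorem mem_ballFinset {r : ℝ} {g : G} : g ∈ ballFinset o Γ r ↔ dist o (g • o) ≤ r ∧ g ∈ Γ :=
  Set.Finite.mem_toFinset _

theorem card_ballFinset (o : Y) (Γ : Set G) (r : ℝ) : (ballFinset o Γ r).card = ballCount o Γ r :=
  (Set.ncard_eq_toFinset_card _ _).symm

theorem ballFinset_mono (o : Y) (Γ : Set G) {r r' : ℝ} (h : r ≤ r') :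
    ballFinset o Γ r ⊆ ballFinset o Γ r' := fun g hg => by
  rw [mem_ballFinset] at hg ⊢
  exact ⟨hg.1.trans h, hg.2⟩

/-- The partial sums of the Poincaré series of `Γ`. -/
noncomputable def poincareSum (o : Y) (Γ : Set G) (σ r : ℝ) : ℝ :=
  ∑ g ∈ ballFinset o Γ r, Real.exp (-(σ * dist o (g • o)))

theorem poincareSum_mono (o : Y) (Γ : Set G) (σ : ℝ) {r r' : ℝ} (h : r ≤ r') :
    poincareSum o Γ σ r ≤ poincareSum o Γ σ r' :=
  Finset.sum_le_sum_of_subset_of_nonneg (ballFinset_mono o Γ h) fun _ _ _ => (Real.exp_pos _).le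

theorem poincareSum_nonneg (o : Y) (Γ : Set G) (σ r : ℝ) : 0 ≤ poincareSum o Γ σ r :=
  Finset.sum_nonneg fun _ _ => (Real.exp_pos _).le

theorem one_le_poincareSum (h1 : 1 ∈ Γ) {r : ℝ} (hr : 0 ≤ r) : 1 ≤ poincareSum o Γ σ r := by
  have := Finset.single_le_sum (f := fun g : G => Real.exp (-(σ * dist o (g • o))))
    (fun _ _ => (Real.exp_pos _).le) (mem_ballFinset.2 ⟨by simpa using hr, h1⟩ : 1 ∈ ballFinset o Γ r)
  simpa [poincareSum] using this

theorem ballCount_mul_exp_le_poincareSum (hσ : 0 ≤ σ) (r : ℝ) :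
    ballCount o Γ r * Real.exp (-(σ * r)) ≤ poincareSum o Γ σ r := by
  rw [← card_ballFinset, ← nsmul_eq_mul]
  refine Finset.card_nsmul_le_sum _ _ _ fun g hg => ?_
  have := (mem_ballFinset.1 hg).1
  gcongr

/-- Each term of the new shell is at most `exp (-(σ * r))`. The set `S` is free so that the shell
can be counted by a ball or by an annulus. -/
theorem poincareSum_add_le (hσ : 0 ≤ σ) (r d : ℝ) {S : Set G} (hS : S.Finite)
    (h : ∀ g ∈ Γ, r < dist o (g • o) → dist o (g • o) ≤ r + d → g ∈ S) :
    poincareSum o Γ σ (r + d) ≤ poincareSum o Γ σ r + S.ncard * Real.exp (-(σ * r)) := by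
  classical
  have hsub : ballFinset o Γ (r + d) ⊆
      ballFinset o Γ r ∪ hS.toFinset.filter fun g => r ≤ dist o (g • o) := by
    intro g hg
    rw [mem_ballFinset] at hg
    rw [Finset.mem_union, mem_ballFinset, Finset.mem_filter, Set.Finite.mem_toFinset]
    rcases le_or_gt (dist o (g • o)) r with h' | h'
    · exact Or.inl ⟨h', hg.2⟩
    · exact Or.inr ⟨h g hg.2 h' hg.1, h'.le⟩
  refine (Finset.sum_le_sum_of_subset_of_nonneg hsub fun _ _ _ => (Real.exp_pos _).le).trans ?_
  have hunion := Finset.sum_union_inter (s₁ := ballFinset o Γ r)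
    (s₂ := hS.toFinset.filter fun g => r ≤ dist o (g • o))
    (f := fun g => Real.exp (-(σ * dist o (g • o))))
  have hinter : 0 ≤ ∑ g ∈ ballFinset o Γ r ∩ hS.toFinset.filter fun g => r ≤ dist o (g • o),
      Real.exp (-(σ * dist o (g • o))) := Finset.sum_nonneg fun _ _ => (Real.exp_pos _).le
  have hlast : ∑ g ∈ hS.toFinset.filter fun g => r ≤ dist o (g • o),
      Real.exp (-(σ * dist o (g • o))) ≤ S.ncard * Real.exp (-(σ * r)) := by
    rw [Set.ncard_eq_toFinset_card _ hS]
    refine (Finset.sum_le_card_nsmul _ _ (Real.exp (-(σ * r))) fun g hg => ?_).trans ?_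
    · have := (Finset.mem_filter.1 hg).2
      gcongr
    · rw [nsmul_eq_mul]
      gcongr
      exact Finset.filter_subset _ _
  have : poincareSum o Γ σ r = ∑ g ∈ ballFinset o Γ r, Real.exp (-(σ * dist o (g • o))) := rfl
  linarith

/-- The Poincaré series converges above the critical exponent. -/
theorem exists_poincareSum_le (h1 : 1 ∈ Γ) (hσ : criticalExponent o Γ < σ) :
    ∃ Θ : ℝ, 0 ≤ Θ ∧ ∀ r, poincareSum o Γ σ r ≤ Θ := by
  obtain ⟨w, hw, hwσ⟩ := EReal.lt_iff_exists_real_btwn.1 hσ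
  rw [EReal.coe_lt_coe_iff] at hwσ
  have hσ0 : 0 ≤ σ := by
    have := (zero_le_criticalExponent (o := o) h1).trans hσ.le
    exact_mod_cast this
  obtain ⟨A, hA, hcount⟩ := exists_ballCount_le_of_criticalExponent_lt h1 hw
  -- The shell between radii `n` and `n + 1` contributes at most `A * exp w * ρ ^ n`.
  set ρ := Real.exp (w - σ) with hρ
  have hρ1 : 0 < 1 - ρ := by
    have := Real.exp_lt_exp.2 (sub_neg_of_lt hwσ)
    rw [Real.exp_zero] at this
    linarith
  set D := A * Real.exp w / (1 - ρ) with hD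
  have hD0 : 0 ≤ D := by positivity
  have hAD : A * Real.exp w = D * (1 - ρ) := by rw [hD, div_mul_cancel₀ _ hρ1.ne']
  have key : ∀ n : ℕ, poincareSum o Γ σ n ≤ poincareSum o Γ σ 0 + D * (1 - ρ ^ n) := by
    intro n
    induction n with
    | zero => simp
    | succ n ih =>
      have h2 := poincareSum_add_le (o := o) (Γ := Γ) hσ0 n 1
        ((orbitBall_finite o (n + 1)).subset (Set.inter_subset_left (t := Γ)))
        (fun g hg _ hgn => ⟨hgn, hg⟩)
      have h3 : (ballCount o Γ (n + 1) : ℝ) * Real.exp (-(σ * n)) ≤ D * (1 - ρ) * ρ ^ n := by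
        have h4 := hcount (n + 1)
        push_cast at h4
        refine (mul_le_mul_of_nonneg_right h4 (Real.exp_pos _).le).trans (le_of_eq ?_)
        rw [← hAD, hρ, ← Real.exp_nat_mul, mul_assoc, mul_assoc, ← Real.exp_add, ← Real.exp_add]
        congr 2; ring
      push_cast
      refine h2.trans ?_
      change _ + (ballCount o Γ (n + 1) : ℝ) * _ ≤ _
      rw [pow_succ]
      linarith
  refine ⟨poincareSum o Γ σ 0 + D, add_nonneg (poincareSum_nonneg _ _ _ _) hD0, fun r => ?_⟩
  obtain ⟨n, hn⟩ := exists_nat_ge r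
  refine ((poincareSum_mono o Γ σ hn).trans (key n)).trans ?_
  have : 0 ≤ D * ρ ^ n := by positivity
  linarith

/-- If a submultiplicative partial Poincaré series is small once, then it stays small, which bounds
the critical exponent. -/
theorem criticalExponent_le_of_poincareSum_le {J n : ℕ} {K lam : ℝ} (hJ : 0 < J) (hK : 0 < K)
    (hσ : 0 ≤ σ)
    (hsub : ∀ r q : ℕ, J ≤ r → J ≤ q → poincareSum o (Set.univ : Set G) σ (r + q : ℕ) ≤
        K * (poincareSum o (Set.univ : Set G) σ r * poincareSum o (Set.univ : Set G) σ q))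
    (hn : J ≤ n) (hlam : 0 ≤ lam)
    (h : K * poincareSum o (Set.univ : Set G) σ n ≤ Real.exp (lam * n)) :
    criticalExponent o (Set.univ : Set G) ≤ (σ + lam : ℝ) := by
  have hn0 : 0 < n := by omega
  have hiter : ∀ k : ℕ, K * poincareSum o (Set.univ : Set G) σ ((k + 1) * n : ℕ) ≤
      Real.exp (lam * n) ^ (k + 1) := by
    intro k
    induction k with
    | zero => simpa using h
    | succ k ih =>
      have h1 := hsub ((k + 1) * n) n (hn.trans (Nat.le_mul_of_pos_left n (by omega))) hn
      rw [show (k + 1) * n + n = (k + 1 + 1) * n by ring] at h1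
      rw [pow_succ]
      calc _ ≤ K * (K * (poincareSum o (Set.univ : Set G) σ ((k + 1) * n : ℕ) *
            poincareSum o (Set.univ : Set G) σ n)) := by gcongr
        _ = (K * poincareSum o (Set.univ : Set G) σ ((k + 1) * n : ℕ)) *
            (K * poincareSum o (Set.univ : Set G) σ n) := by ring
        _ ≤ _ := mul_le_mul ih h (mul_nonneg hK.le (poincareSum_nonneg _ _ _ _)) (by positivity)
  -- The factor `exp (lam * n)` pays for rounding `m` up to a multiple of `n`.
  refine criticalExponent_le_of_ballCount_le (Set.mem_univ _)
    (A := K⁻¹ * Real.exp (lam * n)) fun m => ?_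
  have h1 := hiter (m / n)
  have hm : m ≤ (m / n + 1) * n := by
    have := Nat.div_add_mod m n
    have h4 := Nat.mod_lt m hn0
    rw [add_mul, one_mul, mul_comm (m / n)]; omega
  have h2 : poincareSum o (Set.univ : Set G) σ m ≤
      poincareSum o (Set.univ : Set G) σ ((m / n + 1) * n : ℕ) :=
    poincareSum_mono _ _ _ (by exact_mod_cast hm)
  have h3 := ballCount_mul_exp_le_poincareSum (o := o) (Γ := (Set.univ : Set G)) hσ m
  have h4 : Real.exp (lam * n) ^ (m / n + 1) ≤ Real.exp (lam * n) * Real.exp (lam * m) := by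
    rw [← Real.exp_nat_mul, ← Real.exp_add]
    refine Real.exp_le_exp.2 ?_
    have : ((m / n : ℕ) : ℝ) * n ≤ m := by exact_mod_cast Nat.div_mul_le_self m n
    push_cast
    nlinarith
  have h5 : K * (ballCount o (Set.univ : Set G) m * Real.exp (-(σ * m))) ≤
      Real.exp (lam * n) * Real.exp (lam * m) :=
    ((mul_le_mul_of_nonneg_left (h3.trans h2) hK.le).trans h1).trans h4
  rw [Real.exp_neg] at h5
  rw [add_mul, Real.exp_add]
  have hE := Real.exp_pos (σ * m)
  have h6 : (ballCount o (Set.univ : Set G) m : ℝ) =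
      K⁻¹ * (K * (ballCount o (Set.univ : Set G) m * (Real.exp (σ * m))⁻¹)) * Real.exp (σ * m) := by
    field_simp
  rw [h6]
  calc _ ≤ K⁻¹ * (Real.exp (lam * n) * Real.exp (lam * m)) * Real.exp (σ * m) := by gcongr
    _ = _ := by ring

theorem annulusCount_eq (o : Y) (Δ : ℝ) (n : ℕ) :
    annulusCount G o Δ n = ENNReal.ofReal ((orbitAnnulus G o n Δ).ncard) := by
  rw [annulusCount, ← (orbitAnnulus_finite o n Δ).cast_ncard_eq]
  simp

end Poincare

/-! ### Statistically convex-cocompact actions -/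

theorem one_mem_concaveRegion {G Y : Type*} [Group G] [MetricSpace Y] [MulAction G Y] {o : Y}
    {M₁ M₂ : ℝ} (h0 : 0 ≤ M₂) : (1 : G) ∈ concaveRegion G o M₁ M₂ := by
  refine ⟨fun _ => o, 0, ⟨le_rfl, fun s hs t ht => ?_⟩, Metric.mem_closedBall_self h0, ?_, ?_⟩
  · rw [Set.Icc_self, Set.mem_singleton_iff] at hs ht
    simp [hs, ht]
  · rw [one_smul]; exact Metric.mem_closedBall_self h0
  · rintro t ⟨h1, h2⟩; linarith

theorem notMem_cthickening_of_lt_infDist {Y : Type*} [MetricSpace Y] {X : Set Y} {y : Y} {δ : ℝ}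
    (hδ : 0 ≤ δ) (h : δ < Metric.infDist y X) : y ∉ Metric.cthickening δ X := fun hy => by
  have := ENNReal.toReal_mono ENNReal.ofReal_ne_top (Metric.mem_cthickening_iff.1 hy)
  rw [ENNReal.toReal_ofReal hδ] at this
  exact absurd this (not_le.2 h)

theorem orbitAnnulus_subset {G Y : Type*} [Group G] [MetricSpace Y] [MulAction G Y]
    [IsIsometricSMul G Y] (o p : Y) (n Δ : ℝ) :
    orbitAnnulus G p n Δ ⊆ orbitAnnulus G o n (Δ + 2 * dist o p) := by
  intro g hg
  have h := abs_le.1 (show |dist p (g • p) - n| ≤ Δ from hg)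
  show |dist o (g • o) - n| ≤ _
  have h1 := dist_triangle4 p o (g • o) (g • p)
  have h2 := dist_triangle4 o p (g • p) (g • o)
  rw [dist_smul, dist_comm p o] at h1
  rw [dist_smul, dist_comm p o] at h2
  rw [abs_le]
  constructor <;> linarith [h.1, h.2]

theorem expGrowth_eq {G Y : Type*} [Group G] [MetricSpace Y] [MulAction G Y] (o : Y)
    {ω : ℝ} (hω : criticalExponent o (Set.univ : Set G) = ω) (n : ℕ) :
    expGrowth G o n = ENNReal.ofReal (Real.exp (ω * n)) := by
  rw [expGrowth, hω, ← EReal.exp_coe, EReal.coe_mul, EReal.coe_coe_eq_natCast]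

section SCC

variable {G Y : Type*} [Group G] [MetricSpace Y] [ProperSpace Y] [MulAction G Y]
  [IsIsometricSMul G Y] [ProperlyDiscontinuousSMul G Y] {o : Y} {M₁ M₂ σ : ℝ}

/-- Cutting a geodesic from `o` to `g • o` at time `τ`: either the cut point is near the orbit, or
it lies in an excursion away from the orbit. -/
theorem exists_concave_decomposition (hY : IsGeodesicSpace Y) (hM₁ : 0 ≤ M₁) (hM : M₁ ≤ M₂) (o : Y)
    (g : G) {τ : ℝ} (h0 : 0 ≤ τ) (hτ : τ ≤ dist o (g • o)) :
    ∃ u k w : G, g = u * k * w ∧ k ∈ concaveRegion G o M₁ M₂ ∧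
      dist o (u • o) ≤ τ + M₁ ∧ dist o (w • o) ≤ dist o (g • o) - τ + M₁ ∧
      dist o (u • o) + dist o (k • o) + dist o (w • o) ≤ dist o (g • o) + 4 * M₁ := by
  obtain ⟨γ, L, hγ, hγ0, hγL⟩ := hY o (g • o)
  have hL : dist o (g • o) = L := by rw [← hγL, ← hγ0]; exact hγ.length_eq
  rw [hL] at hτ ⊢
  have hmem : ∀ k : G, Metric.infDist (k • o) (MulAction.orbit G o) ≤ M₁ := fun k => by
    rw [Metric.infDist_zero_of_mem (MulAction.mem_orbit o k)]; exact hM₁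
  obtain ⟨s, hs, t, ht, hsM, htM, hst⟩ := exists_excursion
    (hγ.infDist_continuousOn (MulAction.orbit G o)) (c := M₁)
    (by rw [hγ0]; simpa using hmem 1) (by rw [hγL]; exact hmem g) ⟨h0, hτ⟩
  -- The distance to the orbit is attained, so no margin beyond `M₁` is lost.
  have near : ∀ y : Y, Metric.infDist y (MulAction.orbit G o) ≤ M₁ →
      ∃ u : G, dist y (u • o) ≤ M₁ := fun y hy => by
    obtain ⟨u, -, hu⟩ := exists_forall_dist_smul_le (Set.univ : Set G) Set.univ_nonempty y o
    refine ⟨u, le_trans ((Metric.le_infDist ⟨o, MulAction.mem_orbit_self o⟩).2 ?_) hy⟩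
    rintro _ ⟨k, rfl⟩
    exact hu k trivial
  obtain ⟨u, hu⟩ := near _ hsM
  obtain ⟨v, hv⟩ := near _ htM
  have ds := hγ.dist_eq le_rfl hs.1 (hs.2.trans hτ)
  have dst := hγ.dist_eq hs.1 (hs.2.trans ht.1) ht.2
  have dt := hγ.dist_eq (h0.trans ht.1) ht.2 le_rfl
  rw [hγ0] at ds
  rw [hγL] at dt
  have d1 := dist_triangle o (γ s) (u • o)
  have d2 := dist_triangle4 (u • o) (γ s) (γ t) (v • o)
  have d3 := dist_triangle (v • o) (γ t) (g • o)
  rw [dist_comm (u • o) (γ s)] at d2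
  rw [dist_comm (v • o) (γ t)] at d3
  have ek : dist o ((u⁻¹ * v) • o) = dist (u • o) (v • o) := by
    rw [← dist_smul u, mul_smul, smul_inv_smul]
  have ew : dist o ((v⁻¹ * g) • o) = dist (v • o) (g • o) := by
    rw [← dist_smul v, mul_smul, smul_inv_smul]
  -- Each end of the excursion is replaced by an orbit point within `M₁` and is used in two of the
  -- three distances, which accounts for `4 * M₁`.
  refine ⟨u, u⁻¹ * v, v⁻¹ * g, by group, ?_, by linarith [hs.2], by rw [ew]; linarith [ht.1],
    by rw [ek, ew]; linarith⟩
  refine ⟨_, _, (hγ.sub hs.1 (hs.2.trans ht.1) ht.2).smul u⁻¹, ?_, ?_, fun x hx => ?_⟩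
  · rw [Metric.mem_closedBall, add_zero, ← dist_smul u, smul_inv_smul]
    linarith
  · rw [Metric.mem_closedBall, add_sub_cancel, ← dist_smul u, smul_inv_smul, mul_smul,
      smul_inv_smul]
    linarith
  · refine notMem_cthickening_of_lt_infDist hM₁ ?_
    have h1 := hst (s + x) ⟨by linarith [hx.1], by linarith [hx.2]⟩
    have h2 := Metric.infEDist_smul u⁻¹ (γ (s + x)) (MulAction.orbit G o)
    rw [MulAction.smul_orbit] at h2
    rw [Metric.infDist, h2]
    exact h1

/-- Cutting geodesics makes the partial Poincaré series submultiplicative. -/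
theorem exists_poincareSum_add_le_mul (hY : IsGeodesicSpace Y) (hM₁ : 0 ≤ M₁) (hM : M₁ ≤ M₂)
    (hσ : criticalExponent o (concaveRegion G o M₁ M₂) < σ) :
    ∃ (J : ℕ) (K : ℝ), 0 < J ∧ 0 < K ∧ ∀ r q : ℕ, J ≤ r → J ≤ q →
      poincareSum o (Set.univ : Set G) σ (r + q : ℕ) ≤
        K * (poincareSum o (Set.univ : Set G) σ r * poincareSum o (Set.univ : Set G) σ q) := by
  classical
  have h1 : (1 : G) ∈ concaveRegion G o M₁ M₂ := one_mem_concaveRegion (hM₁.trans hM)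
  have hσ0 : 0 ≤ σ := by
    have := (zero_le_criticalExponent (o := o) h1).trans hσ.le
    exact_mod_cast this
  obtain ⟨Θ, hΘ0, hΘ⟩ := exists_poincareSum_le h1 hσ
  set P := poincareSum o (Set.univ : Set G) σ with hP
  have hP1 : ∀ r : ℝ, 0 ≤ r → 1 ≤ P r := fun r hr => one_le_poincareSum (Set.mem_univ _) hr
  have hP0 : ∀ r : ℝ, 0 ≤ P r := fun r => poincareSum_nonneg _ _ _ _
  have hPm : ∀ r r' : ℝ, r ≤ r' → P r ≤ P r' := fun r r' h => poincareSum_mono _ _ _ h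
  set K₁ := 1 + Real.exp (4 * M₁ * σ) * Θ with hK₁
  have hK₁0 : 0 < K₁ := by positivity
  have step : ∀ r q : ℝ, M₁ ≤ r → 0 ≤ q → P (r + q) ≤ K₁ * (P r * P (q + 2 * M₁)) := by
    intro r q hr hq
    -- Cutting at time `r - M₁` keeps the first factor in the ball of radius `r`, and for `dist o (g
    -- • o) ≤ r + q` the last one in that of radius `q + 2 * M₁`. The triple determines `g`, so the
    -- sum over the shell is bounded by a product of three sums.
    have hdec : ∀ g : G, ∃ x : G × G × G, r - M₁ ≤ dist o (g • o) →
        g = x.1 * x.2.1 * x.2.2 ∧ x.2.1 ∈ concaveRegion G o M₁ M₂ ∧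
        dist o (x.1 • o) ≤ r - M₁ + M₁ ∧
        dist o (x.2.2 • o) ≤ dist o (g • o) - (r - M₁) + M₁ ∧
        dist o (x.1 • o) + dist o (x.2.1 • o) + dist o (x.2.2 • o) ≤
          dist o (g • o) + 4 * M₁ := fun g => by
      by_cases hg : r - M₁ ≤ dist o (g • o)
      · obtain ⟨u, k, w, h⟩ := exists_concave_decomposition hY hM₁ hM o g (sub_nonneg.2 hr) hg
        exact ⟨(u, k, w), fun _ => h⟩
      · exact ⟨(1, 1, 1), fun h => absurd h hg⟩
    choose φ hφ using hdec
    let F : G × G × G → ℝ := fun x => Real.exp (-(σ * dist o (x.1 • o))) *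
      (Real.exp (-(σ * dist o (x.2.1 • o))) * Real.exp (-(σ * dist o (x.2.2 • o))))
    let S := (ballFinset o (Set.univ : Set G) (r + q)).filter fun g => r < dist o (g • o)
    let T := ballFinset o (Set.univ : Set G) r ×ˢ
      ballFinset o (concaveRegion G o M₁ M₂) (r + q + 4 * M₁) ×ˢ
      ballFinset o (Set.univ : Set G) (q + 2 * M₁)
    have hS : ∀ g ∈ S, r < dist o (g • o) ∧ dist o (g • o) ≤ r + q := fun g hg =>
      ⟨(Finset.mem_filter.1 hg).2, (mem_ballFinset.1 (Finset.mem_filter.1 hg).1).1⟩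
    have hsumS : ∑ g ∈ S, Real.exp (-(σ * dist o (g • o))) ≤
        Real.exp (4 * M₁ * σ) * ∑ x ∈ T, F x := by
      have hφS : ∀ g ∈ S, _ := fun g hg => hφ g (by linarith [(hS g hg).1])
      have hinj : Set.InjOn φ S := fun g hg g' hg' h => by
        rw [(hφS g hg).1, (hφS g' hg').1, h]
      have himg : S.image φ ⊆ T := by
        intro x hx
        obtain ⟨g, hg, rfl⟩ := Finset.mem_image.1 hx
        obtain ⟨-, h2, h3, h4, h5⟩ := hφS g hg
        have h6 := (hS g hg).2
        simp only [T, Finset.mem_product, mem_ballFinset, Set.mem_univ, and_true]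
        refine ⟨by linarith, ⟨?_, h2⟩, by linarith⟩
        linarith [dist_nonneg (x := o) (y := (φ g).1 • o),
          dist_nonneg (x := o) (y := (φ g).2.2 • o)]
      rw [Finset.mul_sum]
      refine le_trans ?_ (Finset.sum_le_sum_of_subset_of_nonneg himg fun x _ _ => by positivity)
      rw [Finset.sum_image hinj]
      refine Finset.sum_le_sum fun g hg => ?_
      simp only [F]
      rw [← Real.exp_add, ← Real.exp_add, ← Real.exp_add]
      refine Real.exp_le_exp.2 ?_
      nlinarith [mul_le_mul_of_nonneg_left (hφS g hg).2.2.2.2 hσ0]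
    have hsumT : ∑ x ∈ T, F x ≤ P r * (Θ * P (q + 2 * M₁)) := by
      simp only [T, F]
      rw [Finset.sum_product]
      simp only [← Finset.mul_sum, Finset.sum_product, ← Finset.sum_mul]
      exact mul_le_mul_of_nonneg_left (mul_le_mul_of_nonneg_right (hΘ _) (hP0 _)) (hP0 _)
    have hsplit : P (r + q) ≤ P r + ∑ g ∈ S, Real.exp (-(σ * dist o (g • o))) := by
      rw [hP, poincareSum, ← Finset.sum_filter_add_sum_filter_not _ fun g => r < dist o (g • o),
        add_comm]
      refine add_le_add_left (Finset.sum_le_sum_of_subset_of_nonneg (fun g hg => ?_)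
        fun _ _ _ => (Real.exp_pos _).le) _
      exact mem_ballFinset.2 ⟨not_lt.1 (Finset.mem_filter.1 hg).2, trivial⟩
    have h2 : P r ≤ P r * P (q + 2 * M₁) :=
      le_mul_of_one_le_right (hP0 r) (hP1 _ (by linarith))
    have h3 := mul_le_mul_of_nonneg_left hsumT (Real.exp_pos (4 * M₁ * σ)).le
    rw [hK₁]
    linarith
  -- The excess `2 * M₁` is absorbed by a second use of `step`, which splits `q + J`.
  obtain ⟨J, hJ⟩ := exists_nat_ge (2 * M₁ + 1)
  have hJ0 : 0 < J := by
    have : (0 : ℝ) < J := by linarith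
    exact_mod_cast this
  refine ⟨J, K₁ * (K₁ * P (J + 2 * M₁)), hJ0, by
    have := hP1 (J + 2 * M₁) (by positivity)
    positivity, fun r q hr hq => ?_⟩
  have hr' : (J : ℝ) ≤ r := by exact_mod_cast hr
  have hq' : (J : ℝ) ≤ q := by exact_mod_cast hq
  have h2 := step r q (by linarith) (by linarith)
  have h3 := (hPm (q + 2 * M₁) (q + J) (by linarith)).trans (step q J (by linarith) (by linarith))
  push_cast
  refine h2.trans ?_
  have h4 := mul_le_mul_of_nonneg_left (mul_le_mul_of_nonneg_left h3 (hP0 r)) hK₁0.le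
  linarith

theorem exists_exp_le_annulus (hY : IsGeodesicSpace Y) (hG : IsNonElementary G)
    (hcontr : ∃ h : G, IsContractingElement (Y := Y) h) {p : Y}
    (hscc : IsStatConvexCocompact G p) :
    ∃ ω : ℝ, criticalExponent p (Set.univ : Set G) = ω ∧ ∃ (J : ℕ) (a : ℝ), 0 < a ∧ ∀ n : ℕ,
      a * Real.exp (ω * n) ≤ (orbitAnnulus G p n J).ncard := by
  obtain ⟨M₁, M₂, hM₁, hM, hlt⟩ := hscc
  obtain ⟨σ, hσ, hσω⟩ := EReal.lt_iff_exists_real_btwn.1 hlt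
  have hσ0 : 0 ≤ σ := by
    have := (zero_le_criticalExponent (o := p)
      (one_mem_concaveRegion (G := G) (M₁ := M₁) (hM₁.le.trans hM))).trans hσ.le
    exact_mod_cast this
  obtain ⟨J, K, hJ, hK, hsub⟩ := exists_poincareSum_add_le_mul hY hM₁.le hM hσ
  set P := poincareSum p (Set.univ : Set G) σ with hP
  have hP0 : ∀ r : ℕ, 0 < P r := fun r =>
    lt_of_lt_of_le one_pos (one_le_poincareSum (Set.mem_univ _) (Nat.cast_nonneg r))
  -- Submultiplicativity makes the exponent finite; `lam = K * P J` is admissible because `x ≤ exp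
  -- x`.
  have htop : criticalExponent p (Set.univ : Set G) ≠ ⊤ := fun htop => by
    have := criticalExponent_le_of_poincareSum_le hJ hK hσ0 hsub le_rfl
      (mul_pos hK (hP0 J)).le (by
        have h1 := Real.add_one_le_exp (K * P J * J)
        have h2 : K * P J ≤ K * P J * J :=
          le_mul_of_one_le_right (mul_pos hK (hP0 J)).le (by exact_mod_cast hJ)
        linarith)
    rw [htop, top_le_iff] at this
    exact EReal.coe_ne_top _ this
  have hbot : criticalExponent p (Set.univ : Set G) ≠ ⊥ := fun hbot => by
    rw [hbot] at hσω
    exact not_lt_bot hσω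
  obtain ⟨ω, hω⟩ : ∃ ω : ℝ, criticalExponent p (Set.univ : Set G) = ω :=
    ⟨_, (EReal.coe_toReal htop hbot).symm⟩
  refine ⟨ω, hω, ?_⟩
  rw [hω, EReal.coe_lt_coe_iff] at hσω
  set δ := ω - σ with hδ
  have hδ0 : 0 < δ := sub_pos.2 hσω
  -- A smaller value at a single `n` would bound the critical exponent by something below `σ + δ =
  -- ω`.
  have hlow : ∀ n : ℕ, J ≤ n → Real.exp (δ * n) ≤ K * P n := by
    intro n hn
    by_contra! hcon
    have hn0 : (0 : ℝ) < n := by exact_mod_cast hJ.trans_le hn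
    have hKP := mul_pos hK (hP0 n)
    have h1 : Real.log (K * P n) / n < δ := by
      rw [div_lt_iff₀ hn0, Real.log_lt_iff_lt_exp hKP]; exact hcon
    have h2 := criticalExponent_le_of_poincareSum_le hJ hK hσ0 hsub hn
      (le_max_left 0 (Real.log (K * P n) / n)) (by
        rw [← Real.log_le_iff_le_exp hKP, ← div_le_iff₀ hn0]
        exact le_max_right _ _)
    rw [hω, EReal.coe_le_coe_iff] at h2
    linarith [max_lt hδ0 h1]
  obtain ⟨A, hA, hup⟩ := exists_annulus_le_exp hY hG hcontr p 1 hω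
  have hPup := le_of_increment_le_exp (S := fun n => P n) (A := A * Real.exp σ + P (0 : ℕ)) hδ0
    (by have := hP0 0; positivity) (by linarith [mul_pos hA (Real.exp_pos σ)]) (fun n => by
      have h1 := poincareSum_add_le (o := p) (Γ := (Set.univ : Set G)) hσ0 n 1
        (orbitAnnulus_finite p (n + 1 : ℕ) 1) (fun g _ h1 h2 => by
          show |dist p (g • p) - (n + 1 : ℕ)| ≤ 1
          push_cast
          rw [abs_le]; constructor <;> linarith)
      have h2 := mul_le_mul_of_nonneg_right (hup (n + 1)) (Real.exp_pos (-(σ * n))).le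
      have h3 : A * Real.exp (ω * (n + 1 : ℕ)) * Real.exp (-(σ * n)) =
          A * Real.exp σ * Real.exp (δ * (n + 1 : ℕ)) := by
        rw [mul_assoc, mul_assoc, ← Real.exp_add, ← Real.exp_add, hδ]
        congr 2; push_cast; ring
      have h4 := mul_pos (hP0 0) (Real.exp_pos (δ * (n + 1 : ℕ)))
      have h5 : P (n + 1 : ℕ) = P (n + 1) := by push_cast; rfl
      simp only [h5]
      rw [add_mul]
      linarith)
  set D := (A * Real.exp σ + P (0 : ℕ)) / (1 - Real.exp (-δ)) with hD
  have hD0 : 0 ≤ D := by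
    by_contra! hneg
    have h1 := hPup 0
    have := mul_neg_of_neg_of_pos hneg (Real.exp_pos (δ * (0 : ℕ)))
    linarith [hP0 0]
  -- With this `J'`, the upper bound for `P n` is at most half the lower bound for `P (n + J')`, so
  -- the shell between carries the other half.
  obtain ⟨J', hJ'⟩ : ∃ J' : ℕ, J ≤ J' ∧ D * Real.exp (-(δ * J')) ≤ K⁻¹ / 2 := by
    have h1 : Tendsto (fun n : ℕ => D * Real.exp (-(δ * n))) atTop (𝓝 (D * 0)) := by
      refine Tendsto.const_mul D (Real.tendsto_exp_neg_atTop_nhds_zero.comp ?_)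
      exact tendsto_natCast_atTop_atTop.const_mul_atTop hδ0
    rw [mul_zero] at h1
    have h2 : (0 : ℝ) < K⁻¹ / 2 := by positivity
    obtain ⟨J', h⟩ := ((eventually_ge_atTop J).and (h1.eventually_le_const h2)).exists
    exact ⟨J', h⟩
  have hω0 : 0 ≤ ω := by linarith
  refine ⟨J', min (K⁻¹ / 2 * Real.exp (-(σ * J'))) (Real.exp (-(ω * J'))), by positivity,
    fun N => ?_⟩
  -- For `N ≤ J'` the annulus contains `1`, and the factor `exp (-(ω * J'))` makes the left side at
  -- most `1`.
  rcases le_or_gt N J' with hN | hN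
  · have h1 : (1 : ℝ) ≤ (orbitAnnulus G p N J').ncard := by
      have : 0 < (orbitAnnulus G p N J').ncard := by
        refine (Set.ncard_pos (orbitAnnulus_finite p _ _)).2 ⟨1, ?_⟩
        show |dist p ((1 : G) • p) - N| ≤ J'
        simpa using hN
      exact_mod_cast this
    refine le_trans ?_ h1
    refine (mul_le_mul_of_nonneg_right (min_le_right _ _) (Real.exp_pos _).le).trans ?_
    rw [← Real.exp_add, ← Real.exp_zero]
    refine Real.exp_le_exp.2 ?_
    have : (N : ℝ) ≤ J' := by exact_mod_cast hN
    nlinarith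
  · obtain ⟨n, rfl⟩ := Nat.exists_eq_add_of_le hN.le
    have h1 := poincareSum_add_le (o := p) (Γ := (Set.univ : Set G)) hσ0 n J'
      (orbitAnnulus_finite p (J' + n : ℕ) J') (fun g _ h1 h2 => by
        show |dist p (g • p) - (J' + n : ℕ)| ≤ J'
        push_cast
        have : (0 : ℝ) ≤ J' := by positivity
        rw [abs_le]; constructor <;> linarith)
    have h2 := hlow (J' + n) (by omega)
    have h3 := hPup n
    have h5 : P (J' + n : ℕ) = P (n + J') := by rw [add_comm J' n]; push_cast; rfl
    have h6 : Real.exp (δ * n) = Real.exp (-(δ * J')) * Real.exp (δ * (J' + n : ℕ)) := by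
      rw [← Real.exp_add]; congr 1; push_cast; ring
    have h7 : K⁻¹ * Real.exp (δ * (J' + n : ℕ)) ≤ P (n + J') := by
      rw [inv_mul_le_iff₀ hK, ← h5]; exact h2
    have h8 : P n ≤ K⁻¹ / 2 * Real.exp (δ * (J' + n : ℕ)) := by
      refine h3.trans ?_
      rw [h6, ← mul_assoc]
      exact mul_le_mul_of_nonneg_right hJ'.2 (Real.exp_pos _).le
    have h9 : K⁻¹ / 2 * Real.exp (δ * (J' + n : ℕ)) ≤
        (orbitAnnulus G p (J' + n : ℕ) J').ncard * Real.exp (-(σ * n)) := by linarith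
    refine (mul_le_mul_of_nonneg_right (min_le_left _ _) (Real.exp_pos _).le).trans ?_
    have h10 := mul_le_mul_of_nonneg_right h9 (Real.exp_pos (σ * n)).le
    rw [mul_assoc, mul_assoc, ← Real.exp_add, ← Real.exp_add, neg_add_cancel, Real.exp_zero,
      mul_one] at h10
    refine le_trans (le_of_eq ?_) h10
    rw [mul_assoc, ← Real.exp_add]
    congr 2
    rw [hδ]; push_cast; ring

/-- The critical exponent does not depend on the basepoint. -/
theorem criticalExponent_univ_le (o p : Y) :
    criticalExponent o (Set.univ : Set G) ≤ criticalExponent p (Set.univ : Set G) := by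
  refine EReal.le_of_forall_lt_iff_le.1 fun w hw => ?_
  obtain ⟨A, hA, h⟩ := exists_ballCount_le_of_criticalExponent_lt (Set.mem_univ _) hw
  obtain ⟨d, hd⟩ := exists_nat_ge (2 * dist o p)
  refine criticalExponent_le_of_ballCount_le (Set.mem_univ _) (A := A * Real.exp (w * d))
    fun n => ?_
  have hle : ballCount o (Set.univ : Set G) n ≤ ballCount p (Set.univ : Set G) (n + d : ℕ) := by
    refine Set.ncard_le_ncard (fun g hg => ⟨?_, trivial⟩)
      ((orbitBall_finite p _).subset Set.inter_subset_left)
    have h1 : dist o (g • o) ≤ n := hg.1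
    show dist p (g • p) ≤ (n + d : ℕ)
    have h2 := dist_triangle4 p o (g • o) (g • p)
    rw [dist_smul, dist_comm p o] at h2
    push_cast
    linarith
  have h1 : (ballCount o (Set.univ : Set G) n : ℝ) ≤ ballCount p (Set.univ : Set G) (n + d : ℕ) := by
    exact_mod_cast hle
  refine (h1.trans (h _)).trans (le_of_eq ?_)
  rw [mul_assoc, ← Real.exp_add]
  congr 2; push_cast; ring

end SCC

theorem coarselyLE_of_le_mul {f g : ℕ → ℝ≥0∞} {u v : ℕ → ℝ} (hf : ∀ n, f n = ENNReal.ofReal (u n))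
    (hg : ∀ n, g n = ENNReal.ofReal (v n)) {A : ℝ} (hA : 0 < A)
    (hv : ∀ n, 0 < v n) (h : ∀ n, u n ≤ A * v n) : CoarselyLE f g := by
  -- Since `v n > 0`, replacing `A` by `A + 1` makes the inequality strict.
  refine ⟨(A + 1).toNNReal, by simpa using by linarith, fun n _ => ?_⟩
  rw [hf, hg]
  change _ < ENNReal.ofReal (A + 1) * _
  rw [← ENNReal.ofReal_mul (by linarith), ENNReal.ofReal_lt_ofReal_iff
    (mul_pos (by linarith) (hv n))]
  linarith [h n, hv n]

theorem coarselyLE_annulusCount_expGrowth {G Y : Type*} [Group G] [MetricSpace Y] [ProperSpace Y]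
    [MulAction G Y] [IsIsometricSMul G Y] [ProperlyDiscontinuousSMul G Y]
    (hY : IsGeodesicSpace Y) (hG : IsNonElementary G)
    (hcontr : ∃ h : G, IsContractingElement (Y := Y) h) (o : Y) (Δ : ℝ) :
    CoarselyLE (annulusCount G o Δ) (expGrowth G o) := by
  have h0 := zero_le_criticalExponent (o := o) (Set.mem_univ (1 : G))
  by_cases htop : criticalExponent o (Set.univ : Set G) = ⊤
  -- With infinite exponent the right side is `⊤`; this needs `n ≥ 1`, as `⊤ * 0 = 0`.
  · refine ⟨1, one_pos, fun n hn => ?_⟩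
    have hexp : expGrowth G o n = ⊤ := by
      rw [expGrowth, htop, EReal.top_mul_of_pos (by exact_mod_cast hn), EReal.exp_top]
    rw [hexp, annulusCount_eq]
    simp
  · have hω := EReal.coe_toReal htop (ne_bot_of_le_ne_bot EReal.zero_ne_bot h0)
    obtain ⟨A, hA, h⟩ := exists_annulus_le_exp hY hG hcontr o Δ hω.symm
    exact coarselyLE_of_le_mul (annulusCount_eq o Δ) (expGrowth_eq o hω.symm) hA
      (fun n => Real.exp_pos _) h

theorem mainTheorem2 {G Y : Type*} [Group G] [MetricSpace Y] [ProperSpace Y]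
    [MulAction G Y] [IsIsometricSMul G Y] [ProperlyDiscontinuousSMul G Y]
    (hY : IsGeodesicSpace Y) (hG : IsNonElementary G)
    (hcontr : ∃ h : G, IsContractingElement (Y := Y) h) (o : Y) :
    Tendsto (growthQuotient o (Set.univ : Set G)) atTop
        (𝓝 (criticalExponent o (Set.univ : Set G))) ∧
      (∀ Δ : ℝ, 0 < Δ → CoarselyLE (annulusCount G o Δ) (expGrowth G o)) ∧
      ((∃ p : Y, IsStatConvexCocompact G p) →
        ∃ Δ : ℝ, 0 < Δ ∧ CoarselyEq (annulusCount G o Δ) (expGrowth G o)) := by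
  refine ⟨tendsto_of_le_liminf_of_limsup_le (criticalExponent_le_liminf hY hG hcontr o) le_rfl,
    fun Δ _ => coarselyLE_annulusCount_expGrowth hY hG hcontr o Δ, ?_⟩
  rintro ⟨p, hp⟩
  obtain ⟨ω, hω, J, a, ha, h⟩ := exists_exp_le_annulus hY hG hcontr hp
  have hωo : criticalExponent o (Set.univ : Set G) = ω :=
    (le_antisymm (criticalExponent_univ_le o p) (criticalExponent_univ_le p o)).trans hω
  -- Changing the basepoint from `p` to `o` costs `2 * dist o p` in width; the `1` ensures
  -- positivity.
  refine ⟨J + 2 * dist o p + 1, by positivity, coarselyLE_annulusCount_expGrowth hY hG hcontr o _,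
    coarselyLE_of_le_mul (expGrowth_eq o hωo) (annulusCount_eq o _) (inv_pos.2 ha) ?_ ?_⟩
  all_goals
    intro n
    have hle : ((orbitAnnulus G p n J).ncard : ℝ) ≤
        (orbitAnnulus G o n (J + 2 * dist o p + 1)).ncard := by
      refine Nat.cast_le.2 (Set.ncard_le_ncard (fun g hg => ?_) (orbitAnnulus_finite o _ _))
      have h1 := orbitAnnulus_subset o p n J hg
      show |dist o (g • o) - n| ≤ _
      exact le_trans (show |dist o (g • o) - n| ≤ J + 2 * dist o p from h1) (by linarith)
    have hpos := mul_pos ha (Real.exp_pos (ω * n))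
  · linarith [h n]
  · rw [le_inv_mul_iff₀ ha]
    linarith [h n]
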